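/- **Corollary (computational complexity).** Consider an episodic POMDP with horizon $H\ge 1$, finite action set $\mathcal A$ with $|\mathcal A|=A\ge 1$, arbitrary latent state space $\mathcal S$ and observation space $\mathcal O$, fixed initial latent state $s_0$, deterministic latent transitions $s_{h+1}=p_h(s_h,a_h)$, emission laws $\mathbb O_h(\cdot\mid s)$ on $\mathcal O$, and reward laws $\mathbb Y_h(\cdot\mid s,a)$ on $[0,1]$ with means $r_h(s,a)$. Let $Q^\star_h(s,a)=r_h(s,a)+\max_{a'}Q^\star_{h+1}(p_h(s,a),a')$ with $Q^\star_H=0$, and $V^\star_h(s)=\max_a Q^\star_h(s,a)$. Let $\psi:\mathcal O\to\mathbb R^d$ be measurable with $\|\psi(o)\|\le 1$ for all $o$, and let $\phi:\mathcal S\to\mathbb R^{d_s}$, $d_s\geq 1$. Assume, for all $0\le h<H$: 1. there is a matrix $G_h\in\mathbb R^{d\times d_s}$ with a left inverse such that $\mathbb E_{o\sim\mathbb O_h(\cdot\mid s)}[\psi(o)]=G_h\phi(s)$ for all $s$; 2. for each $a$ there is $w^\star_{a;h}\in\mathbb R^{d_s}$ with $\|w^\star_{a;h}\|\le W$ and $Q^\star_h(s,a)=\langle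 w^\star_{a;h},\phi(s)\rangle$ for all $s$; 3. whenever $V^\star_h(s)-Q^\star_h(s,a)>0$, it is at least $\Delta$, where $\Delta>0$. Let $\Theta=W/\min_h\eta(G_h)$, where $\eta$ is the smallest singular value, and let $0<\delta<1$. For a sequence of actions $a_{0:h-1}$ let $s_h(a_{0:h-1})$ be the latent state it leads to from $s_0$. *The algorithm.* It has parameters $M\in\mathbb N_{>0}$, $\varepsilon>0$, $\lambda>0$, and keeps initially empty datasets $\mathcal D_h$ of vectors in $\mathbb R^d$ and $\mathcal D_{a;h}$ of pairs in $\mathbb R^d\times\mathbb R$. Put $\Sigma_h=\lambda I+\sum_{x\in\mathcal D_h}xx^\top$ and $\hat\theta_{a;h}=\Sigma_h^{-1}\sum_{(x,y)\in\mathcal D_{a;h}}y\,x$. Call $x$ *covered* at step $h$ if $x^\top\Sigma_h^{-1}x\le\varepsilon^2$. The estimate $\hat x_h(a_{0:h-1})$ is the mean of $\psi(o_h)$ over $M$ fresh episodes in which $a_{0:h-1}$ is played, and $\hat r_h(a_{0:h-1},a)$ is the mean reward at step $h$ over $M$ fresh episodes in which $a_{0:h-1},a$ is played. - To *explore* $(a_{0:h-1},x)$: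 for each $a'\in\mathcal A$ compute $y_{a'}=\hat r_h(a_{0:h-1},a')+\mathrm{ComputeV}(h+1;a_{0:h-1},a')$ and add $(x,y_{a'})$ to $\mathcal D_{a';h}$; then add $x$ to $\mathcal D_h$. - $\mathrm{ComputeV}(h;a_{0:h-1})$: if $h=H$, return $0$. If $h=H-1$, return $\max_a\hat r_h(a_{0:h-1},a)$. Otherwise compute $x=\hat x_h(a_{0:h-1})$. If $x$ is covered, let $a_h\in\arg\max_a\langle\hat\theta_{a;h},x\rangle$ and return $\hat r_h(a_{0:h-1},a_h)+\mathrm{ComputeV}(h+1;a_{0:h-1},a_h)$. If not, explore $(a_{0:h-1},x)$ and return $\max_a y_a$. - Main loop: repeat the following. For $h=0,\dots,H-1$ compute $x_h=\hat x_h(a_{0:h-1})$ and $a_h\in\arg\max_a\langle\hat\theta_{a;h},x_h\rangle$. If every $x_h$ is covered at step $h$, output $a_{0:H-1}$ and stop. Otherwise take the smallest $h$ such that $x_h$ is not covered and explore $(a_{0:h-1},x_h)$. *Cost.* Each operation $+,-,\times,\div$ on real numbers, each comparison of two real numbers, each start of an episode, each sampling of an observation, each played action (with the sampling of its reward), and each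 reading of one coordinate of a feature vector $\psi(o)$ costs one unit. Matrices $\Sigma_h^{-1}$ are computed from these operations by rank-one updates. *Claim.* There is a universal polynomial $P$ in six variables such that, for all $H,d,A,\Theta,\delta,\Delta$, the parameters $M,\varepsilon,\lambda$ can be chosen as functions of $(H,d,A,\Theta,\delta,\Delta)$ only so that, for every POMDP and features as above, the algorithm always terminates, at total cost at most $$P\bigl(H,d,\Theta,\ln(1/\delta),1/\Delta,A\bigr),$$ and, with probability at least $1-\delta$, its output is an action sequence that maximizes the expected total reward $\mathbb E[\sum_{h<H}r_h]$ among all (history-dependent, possibly randomized) policies. -/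

import Mathlib

open MeasureTheory

noncomputable section

namespace EQDP

/-! ### The model -/

/-- An episodic POMDP with `A` actions whose latent transitions are deterministic (`next h s a` is
the point at which the Dirac transition law from `(s, a)` at step `h` sits), with arbitrary latent
and observation spaces, stochastic emissions and stochastic rewards in `[0, 1]`. Steps are indexed
by `ℕ`; with horizon `H` only the steps `h < H` are ever used. -/
structure DetPOMDP (S : Type*) (O : Type*) [MeasurableSpace O] (A : ℕ) where
  /-- the initial latent state -/
  init : S
  /-- the deterministic latent transition -/
  next : ℕ → S → Fin A → S
  /-- the law of the observation emitted at step `h` in a latent state -/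
  emission : ℕ → S → Measure O
  /-- the law of the reward at step `h` in a latent state under an action -/
  reward : ℕ → S → Fin A → Measure ℝ
  emission_prob : ∀ h s, IsProbabilityMeasure (emission h s)
  reward_prob : ∀ h s a, IsProbabilityMeasure (reward h s a)
  reward_mem : ∀ h s a, ∀ᵐ x ∂(reward h s a), x ∈ Set.Icc (0 : ℝ) 1

attribute [instance] DetPOMDP.emission_prob DetPOMDP.reward_prob

namespace DetPOMDP

variable {S : Type*} {O : Type*} [MeasurableSpace O] {A : ℕ} (𝓜 : DetPOMDP S O A)

/-- The mean reward `r_h(s, a)`. -/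
def meanReward (h : ℕ) (s : S) (a : Fin A) : ℝ := ∫ x, x ∂(𝓜.reward h s a)

/-- The latent state reached from `s` at step `h` by playing a list of actions. -/
def latentFrom : ℕ → S → List (Fin A) → S
  | _, s, [] => s
  | h, s, a :: l => latentFrom (h + 1) (𝓜.next h s a) l

/-- The latent state `s_h(a_{0:h-1})` reached from the initial state, with `h` the length of the
list of actions. -/
def latent (l : List (Fin A)) : S := 𝓜.latentFrom 0 𝓜.init l

/-- The optimal latent value at step `h` with `k` steps to go, by backward recursion. -/
def optValue [NeZero A] : ℕ → ℕ → S → ℝ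
  | 0, _, _ => 0
  | k + 1, h, s => Finset.univ.sup' Finset.univ_nonempty
      fun a : Fin A => 𝓜.meanReward h s a + optValue k (h + 1) (𝓜.next h s a)

/-- `V⋆_h(s)` for horizon `H`. -/
def Vstar [NeZero A] (H h : ℕ) (s : S) : ℝ := 𝓜.optValue (H - h) h s

/-- `Q⋆_h(s, a) = r_h(s, a) + V⋆_{h+1}(p_h(s, a))` for horizon `H` and `h < H`. -/
def Qstar [NeZero A] (H h : ℕ) (s : S) (a : Fin A) : ℝ :=
  𝓜.meanReward h s a + 𝓜.Vstar H (h + 1) (𝓜.next h s a)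

/-- A (possibly randomized) policy: from the past observations, actions and rewards, oldest first,
and the current observation, a distribution over actions. -/
abbrev Policy (O : Type*) (A : ℕ) := List (O × Fin A × ℝ) → O → PMF (Fin A)

/-- The expected total reward collected by a policy during `k` more steps, starting at step `h` in
latent state `s` with a given history. -/
def valueFrom (π : Policy O A) : ℕ → ℕ → S → List (O × Fin A × ℝ) → ℝ
  | 0, _, _, _ => 0
  | k + 1, h, s, hist =>
      ∫ o, ∑ a : Fin A, (π hist o a).toReal *
        ∫ x, (x + valueFrom π k (h + 1) (𝓜.next h s a) (hist ++ [(o, a, x)]))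
          ∂(𝓜.reward h s a) ∂(𝓜.emission h s)

/-- The expected total reward `𝔼_π[∑_h r_h]` of a policy in an episode of `H` steps. -/
def value (H : ℕ) (π : Policy O A) : ℝ := 𝓜.valueFrom π H 0 𝓜.init []

/-- The policy that plays a fixed sequence of actions, whatever it observes. -/
def openLoop [NeZero A] (l : List (Fin A)) : Policy O A :=
  fun hist _ => PMF.pure (l.getD hist.length 0)

/-- `l` is a sequence of `H` actions which is a globally optimal policy: no history-dependent
policy has larger expected total reward. -/
def IsOptimalSeq [NeZero A] (H : ℕ) (l : List (Fin A)) : Prop :=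
  l.length = H ∧ ∀ π : Policy O A, 𝓜.value H π ≤ 𝓜.value H (openLoop l)

/-- `G_h` is a left-invertible linear conditional mean embedding of the emission law, for each
`h < H`, with state feature `φ` and observation feature `ψ`. -/
def IsMeanEmbedding (H : ℕ) {d dₛ : ℕ} (ψ : O → EuclideanSpace ℝ (Fin d))
    (φ : S → EuclideanSpace ℝ (Fin dₛ)) (G : Fin H → Matrix (Fin d) (Fin dₛ) ℝ) : Prop :=
  ∀ h : Fin H, (∀ s, ∫ o, ψ o ∂(𝓜.emission h s) = Matrix.toEuclideanLin (G h) (φ s)) ∧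
    ∃ L : Matrix (Fin dₛ) (Fin d) ℝ, L * G h = 1

/-- `Q⋆` is linear in the state feature, with weights of norm at most `W`. -/
def LinearQstar [NeZero A] (H : ℕ) {dₛ : ℕ} (φ : S → EuclideanSpace ℝ (Fin dₛ)) (W : ℝ) : Prop :=
  ∀ h < H, ∀ a : Fin A, ∃ w : EuclideanSpace ℝ (Fin dₛ), ‖w‖ ≤ W ∧
    ∀ s, 𝓜.Qstar H h s a = inner ℝ w (φ s)

/-- Every positive gap `V⋆_h(s) - Q⋆_h(s, a)` is at least `Δ`. -/
def HasGap [NeZero A] (H : ℕ) (Δ : ℝ) : Prop :=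
  ∀ h < H, ∀ (s : S) (a : Fin A), 0 < 𝓜.Vstar H h s - 𝓜.Qstar H h s a →
    Δ ≤ 𝓜.Vstar H h s - 𝓜.Qstar H h s a

end DetPOMDP

/-- The smallest singular value of a `d × dₛ` matrix with `0 < dₛ ≤ d`. -/
def minSingularValue {d dₛ : ℕ} (G : Matrix (Fin d) (Fin dₛ) ℝ) : ℝ :=
  (Matrix.toEuclideanLin G).singularValues (dₛ - 1)

/-! ### The machine

A program is a state transformer. Its only access to real arithmetic is through `add`, `sub`,
`mul`, `div`, `le`, and its only access to the POMDP is through `reset`, `observe`, `act`; each of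
these is charged to the counter `steps`. -/

/-- A vector as an array of real numbers. -/
abbrev Vec (d : ℕ) := Fin d → ℝ

structure Machine (A d : ℕ) where
  /-- number of elementary operations performed so far -/
  steps : ℕ
  /-- number of the current episode -/
  episode : ℕ
  /-- the actions played in the current episode -/
  played : List (Fin A)
  /-- the datasets `𝒟_h`, most recent entry first -/
  feats : ℕ → List (Vec d)
  /-- the datasets `𝒟_{a;h}`, most recent entry first -/
  pairs : Fin A → ℕ → List (Vec d × ℝ)

/-- The machine at the start, with empty datasets. -/
def Machine.start (A d : ℕ) : Machine A d := ⟨0, 0, [], fun _ => [], fun _ _ => []⟩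

abbrev Prog (A d : ℕ) := StateM (Machine A d)

/-- What the environment answers in each episode: the feature `ψ(o_h)` of the observation after
actions `a_{0:h-1}`, and the reward after actions `a_{0:h-1}` and the further action `a_h`. -/
structure Env (A d : ℕ) where
  feat : ℕ → List (Fin A) → Vec d
  rew : ℕ → List (Fin A) → Fin A → ℝ

section Programs

variable {A d : ℕ}

/-- Charge `n` elementary operations. -/
def charge (n : ℕ) : Prog A d Unit := modify fun m => { m with steps := m.steps + n }

def add (x y : ℝ) : Prog A d ℝ := do charge 1; pure (x + y)
def sub (x y : ℝ) : Prog A d ℝ := do charge 1; pure (x - y)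
def mul (x y : ℝ) : Prog A d ℝ := do charge 1; pure (x * y)
def div (x y : ℝ) : Prog A d ℝ := do charge 1; pure (x / y)
def le (x y : ℝ) : Prog A d Bool := do charge 1; pure (decide (x ≤ y))

/-- Start a new episode. -/
def reset : Prog A d Unit := do
  charge 1
  modify fun m => { m with episode := m.episode + 1, played := [] }

/-- Sample the current observation and read the `d` coordinates of its feature. -/
def observe (E : Env A d) : Prog A d (Vec d) := do
  charge (1 + d)
  let m ← get
  pure (E.feat m.episode m.played)

/-- Play an action and sample its reward. -/
def act (E : Env A d) (a : Fin A) : Prog A d ℝ := do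
  charge 1
  let m ← get
  set { m with played := m.played ++ [a] }
  pure (E.rew m.episode m.played a)

/-- `𝒟_h := 𝒟_h + {x}` -/
def storeFeat (h : ℕ) (x : Vec d) : Prog A d Unit :=
  modify fun m => { m with feats := Function.update m.feats h (x :: m.feats h) }

/-- `𝒟_{a;h} := 𝒟_{a;h} + {(x, y)}` -/
def storePair (a : Fin A) (h : ℕ) (x : Vec d) (y : ℝ) : Prog A d Unit :=
  modify fun m => { m with
    pairs := Function.update m.pairs a
      (Function.update (m.pairs a) h ((x, y) :: m.pairs a h)) }

/-- Run a program for each index in turn and collect the results. -/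
def tabulate {α : Type} : (n : ℕ) → (Fin n → Prog A d α) → Prog A d (Fin n → α)
  | 0, _ => pure Fin.elim0
  | n + 1, f => do
      let x ← f 0
      let xs ← tabulate n fun i => f i.succ
      pure (Fin.cons x xs)

/-- Run a program for each index in turn and add up the results. -/
def sumUp : (n : ℕ) → (Fin n → Prog A d ℝ) → Prog A d ℝ
  | 0, _ => pure 0
  | n + 1, f => do
      let s ← sumUp n fun i => f i.castSucc
      let x ← f (Fin.last n)
      add s x

/-! Linear algebra -/

def vecAdd (x y : Vec d) : Prog A d (Vec d) := tabulate d fun i => add (x i) (y i)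

def dot (x y : Vec d) : Prog A d ℝ := sumUp d fun i => mul (x i) (y i)

def matVec (P : Fin d → Vec d) (x : Vec d) : Prog A d (Vec d) := tabulate d fun i => dot (P i) x

/-- `Σ⁻¹` for `Σ = ∑ x xᵀ + lam I`, the sum being over a list of vectors, computed by rank-one
updates `(Σ + x xᵀ)⁻¹ = Σ⁻¹ - u uᵀ / (1 + xᵀ u)` with `u = Σ⁻¹ x`
(see `invGram_eq` below). -/
def invGram (lam : ℝ) : List (Vec d) → Prog A d (Fin d → Vec d)
  | [] => tabulate d fun i => tabulate d fun j => if i = j then div 1 lam else pure 0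
  | x :: l => do
      let P ← invGram lam l
      let u ← matVec P x
      let s ← dot x u
      let c ← add 1 s
      tabulate d fun i => tabulate d fun j => do
        let p ← mul (u i) (u j)
        let q ← div p c
        sub (P i j) q

/-- `∑ x y` over a list of pairs `(x, y)`. -/
def moment : List (Vec d × ℝ) → Prog A d (Vec d)
  | [] => pure 0
  | z :: l => do
      let s ← moment l
      let t ← tabulate d fun i => mul (z.1 i) z.2
      vecAdd s t

/-- The index of a largest entry. -/
def argmaxFrom (v : Fin A → ℝ) : List (Fin A) → Fin A → Prog A d (Fin A)
  | [], b => pure b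
  | a :: l, b => do
      if ← le (v a) (v b) then argmaxFrom v l b else argmaxFrom v l a

def argmax [NeZero A] (v : Fin A → ℝ) : Prog A d (Fin A) := argmaxFrom v (List.finRange A) 0

/-! Sampling -/

/-- Play a list of actions in the current episode. -/
def execute (E : Env A d) : List (Fin A) → Prog A d Unit
  | [] => pure ()
  | a :: l => do
      let _ ← observe E
      let _ ← act E a
      execute E l

/-- The sum of the features of `n` observations after `l`, each in a fresh episode. -/
def featureSum (E : Env A d) (l : List (Fin A)) : ℕ → Prog A d (Vec d)
  | 0 => pure 0
  | n + 1 => do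
      let s ← featureSum E l n
      reset
      execute E l
      let x ← observe E
      vecAdd s x

/-- The estimated feature `x̂_h(a_{0:h-1})` from `M` samples. -/
def featureMean (E : Env A d) (M : ℕ) (l : List (Fin A)) : Prog A d (Vec d) := do
  let s ← featureSum E l M
  tabulate d fun i => div (s i) M

/-- The sum of the rewards of `n` plays of action `a` after `l`, each in a fresh episode. -/
def rewardSum (E : Env A d) (l : List (Fin A)) (a : Fin A) : ℕ → Prog A d ℝ
  | 0 => pure 0
  | n + 1 => do
      let s ← rewardSum E l a n
      reset
      execute E l
      let _ ← observe E
      let x ← act E a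
      add s x

/-- The estimated reward `r̂_h(s_h(a_{0:h-1}), a)` from `M` samples. -/
def rewardMean (E : Env A d) (M : ℕ) (l : List (Fin A)) (a : Fin A) : Prog A d ℝ := do
  let s ← rewardSum E l a M
  div s M

/-! The algorithm -/

/-- The input parameters of the algorithm. -/
structure Params where
  M : ℕ
  ε : ℝ
  lam : ℝ

/-- Whether `‖x‖_{Σ_h⁻¹(𝒟_h)} ≤ ε`, tested as `xᵀ Σ_h⁻¹ x ≤ ε²`. -/
def covered (p : Params) (h : ℕ) (x : Vec d) : Prog A d Bool := do
  let m ← get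
  let P ← invGram p.lam (m.feats h)
  let u ← matVec P x
  let q ← dot x u
  let e ← mul p.ε p.ε
  le q e

/-- `argmax_a ⟨θ̂_{a;h}(𝒟_{a;h}), x⟩` for the ridge regression estimates `θ̂_{a;h}`. -/
def greedy [NeZero A] (p : Params) (h : ℕ) (x : Vec d) : Prog A d (Fin A) := do
  let m ← get
  let v ← tabulate A fun a => do
    let P ← invGram p.lam (m.feats h)
    let b ← moment (m.pairs a h)
    let θ ← matVec P b
    dot θ x
  argmax v

/-- The treatment of a feature `x = x̂_h(l)` that is not covered: try each action after `l`, use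
`V` to estimate the value after it, store the results, and return the estimates `y_{a;h}`. -/
def explore (E : Env A d) (p : Params) (V : List (Fin A) → Prog A d ℝ) (l : List (Fin A))
    (x : Vec d) : Prog A d (Fin A → ℝ) := do
  let y ← tabulate A fun a => do
    let r ← rewardMean E p.M l a
    let v ← V (l ++ [a])
    let y ← add r v
    storePair a l.length x y
    pure y
  storeFeat l.length x
  pure y

/-- The subroutine `Compute-V⋆(h; a_{0:h-1})`. The first argument is the number `H - h` of steps
to go; at `h = H` the value is zero. -/
def computeV [NeZero A] (E : Env A d) (p : Params) : ℕ → List (Fin A) → Prog A d ℝ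
  | 0, _ => pure 0
  | 1, l => do
      let r ← tabulate A fun a => rewardMean E p.M l a
      let b ← argmax r
      pure (r b)
  | k + 2, l => do
      let x ← featureMean E p.M l
      if ← covered p l.length x then
        let a ← greedy p l.length x
        let r ← rewardMean E p.M l a
        let v ← computeV E p (k + 1) (l ++ [a])
        add r v
      else
        let y ← explore E p (fun l' => computeV E p (k + 1) l') l x
        let b ← argmax y
        pure (y b)

/-- The for loop of the main program: starting after the actions `l`, estimate the feature and
choose the greedy action for `k` more steps. Returns all actions and the new features. -/
def forward [NeZero A] (E : Env A d) (p : Params) :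
    ℕ → List (Fin A) → Prog A d (List (Fin A) × List (Vec d))
  | 0, l => pure (l, [])
  | k + 1, l => do
      let x ← featureMean E p.M l
      let a ← greedy p l.length x
      let z ← forward E p k (l ++ [a])
      pure (z.1, x :: z.2)

/-- The smallest step whose feature is not covered, with that feature, the features listed being
those of the steps `h, h + 1, …`. -/
def firstUncovered (p : Params) : ℕ → List (Vec d) → Prog A d (Option (ℕ × Vec d))
  | _, [] => pure none
  | h, x :: xs => do
      if ← covered p h x then firstUncovered p (h + 1) xs else pure (some (h, x))

/-- One round of the main while loop; it returns `some` when the algorithm terminates. -/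
def round [NeZero A] (E : Env A d) (p : Params) (H : ℕ) : Prog A d (Option (List (Fin A))) := do
  let z ← forward E p H []
  let u ← firstUncovered p 0 z.2
  match u with
  | none => pure (some z.1)
  | some (h, x) => do
      let _ ← explore E p (computeV E p (H - (h + 1))) (z.1.take h) x
      pure none

/-- The main while loop, cut off after `n` rounds. -/
def rounds [NeZero A] (E : Env A d) (p : Params) (H : ℕ) :
    ℕ → Prog A d (Option (List (Fin A)))
  | 0 => pure none
  | n + 1 => do
      let r ← round E p H
      match r with
      | some l => pure (some l)
      | none => rounds E p H n

/-- The algorithm terminates with the output `l` after `c` elementary operations. -/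
def Terminates [NeZero A] (E : Env A d) (p : Params) (H : ℕ) (l : List (Fin A)) (c : ℕ) : Prop :=
  ∃ n, ((rounds E p H n).run (Machine.start A d)).1 = some l ∧
    ((rounds E p H n).run (Machine.start A d)).2.steps = c

end Programs

/-! ### The value of the inversion routine -/

section InvGram

variable {A d : ℕ}

theorem tabulate_fst {α : Type} (n : ℕ) (f : Fin n → Prog A d α) (v : Fin n → α)
    (hf : ∀ i m, ((f i).run m).1 = v i) (m : Machine A d) : ((tabulate n f).run m).1 = v := by
  induction n generalizing m with
  | zero => exact Subsingleton.elim _ _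
  | succ n ih =>
    funext i
    have h1 := ih (fun i => f i.succ) (fun i => v i.succ) (fun i m => hf i.succ m)
      ((f 0).run m).2
    have h0 := hf 0 m
    have : ((tabulate (n + 1) f).run m).1 = Fin.cons ((f 0).run m).1
      ((tabulate n (fun i => f i.succ)).run ((f 0).run m).2).1 := rfl
    rw [this, h0, h1]
    refine Fin.cases ?_ (fun j => ?_) i <;> simp

theorem sumUp_fst (n : ℕ) (f : Fin n → Prog A d ℝ) (v : Fin n → ℝ)
    (hf : ∀ i m, ((f i).run m).1 = v i) (m : Machine A d) :
    ((sumUp n f).run m).1 = ∑ i, v i := by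
  induction n generalizing m with
  | zero =>
    have : ((sumUp 0 f).run m).1 = 0 := rfl
    simpa using this
  | succ n ih =>
    have h1 := ih (fun i => f i.castSucc) (fun i => v i.castSucc) (fun i m => hf i.castSucc m) m
    have h0 := hf (Fin.last n) ((sumUp n fun i => f i.castSucc).run m).2
    have : ((sumUp (n + 1) f).run m).1 = ((sumUp n fun i => f i.castSucc).run m).1 +
      ((f (Fin.last n)).run ((sumUp n fun i => f i.castSucc).run m).2).1 := rfl
    rw [this, h0, h1, Fin.sum_univ_castSucc]

theorem dot_fst (x y : Vec d) (m : Machine A d) : ((dot x y).run m).1 = x ⬝ᵥ y :=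
  sumUp_fst d _ (fun i => x i * y i) (fun _ _ => rfl) m

theorem matVec_fst (P : Fin d → Vec d) (x : Vec d) (m : Machine A d) :
    ((matVec P x).run m).1 = (Matrix.of P).mulVec x :=
  tabulate_fst d _ _ (fun i m => dot_fst (P i) x m) m

/-- The regularized Gram matrix `∑ x xᵀ + lam I`. -/
def gram (lam : ℝ) (l : List (Vec d)) : Matrix (Fin d) (Fin d) ℝ :=
  (l.map fun x => Matrix.vecMulVec x x).sum + lam • (1 : Matrix (Fin d) (Fin d) ℝ)

theorem gram_posDef {lam : ℝ} (hlam : 0 < lam) (l : List (Vec d)) : (gram lam l).PosDef := by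
  induction l with
  | nil => simpa [gram] using Matrix.PosDef.one.smul hlam
  | cons x l ih =>
    have : gram lam (x :: l) = gram lam l + Matrix.vecMulVec x x := by
      simp [gram, add_comm, add_left_comm]
    rw [this]
    refine ih.add_posSemidef ?_
    simpa using Matrix.posSemidef_vecMulVec_self_star x

theorem invGram_eq {lam : ℝ} (hlam : 0 < lam) (l : List (Vec d)) (m : Machine A d) :
    ((invGram lam l).run m).1 = (gram lam l)⁻¹ := by
  induction l generalizing m with
  | nil =>
    have h : ((invGram lam []).run m).1 = (lam⁻¹ • (1 : Matrix (Fin d) (Fin d) ℝ)) := by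
      refine tabulate_fst d _ _ (fun i m => tabulate_fst d _ _ (fun j m => ?_) m) m
      by_cases hij : i = j
      · subst hij
        have : ((div 1 lam : Prog A d ℝ).run m).1 = 1 / lam := rfl
        simp [this]
      · rw [if_neg hij]
        have : ((pure 0 : Prog A d ℝ).run m).1 = 0 := rfl
        exact this.trans (by simp [hij])
    rw [h]
    refine (Matrix.inv_eq_right_inv ?_).symm
    simp [gram, smul_smul, hlam.ne']
  | cons x l ih =>
    set B := gram lam l with hB
    have hpd : B.PosDef := gram_posDef hlam l
    have hdet : IsUnit B.det := (Matrix.isUnit_iff_isUnit_det _).1 hpd.isUnit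
    have hsymm : (B⁻¹).transpose = B⁻¹ := by
      simpa using hpd.inv.isHermitian.eq
    set u := B⁻¹.mulVec x with hu
    have hpos : 0 ≤ x ⬝ᵥ u := by
      simpa using hpd.inv.posSemidef.dotProduct_mulVec_nonneg x
    have h : ((invGram lam (x :: l)).run m).1 =
        fun i j => B⁻¹ i j - u i * u j / (1 + x ⬝ᵥ u) := by
      set m1 := ((invGram lam l).run m).2
      set P := ((invGram lam l).run m).1 with hP
      set v := ((matVec P x).run m1).1 with hv
      set m2 := ((matVec P x).run m1).2
      have hPB : P = B⁻¹ := ih m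
      have hvu : v = u := by rw [hv, matVec_fst, hPB]; rfl
      have hs : ((dot x v).run m2).1 = x ⬝ᵥ u := by rw [dot_fst, hvu]
      rw [← hPB, ← hvu]
      refine tabulate_fst d _ _ (fun i m => tabulate_fst d _ _ (fun j m => ?_) m) _
      change P i j - v i * v j / (1 + ((dot x v).run m2).1) = _
      rw [hs, hvu]
    rw [h]
    refine (Matrix.inv_eq_right_inv ?_).symm
    have hg : gram lam (x :: l) = B + Matrix.vecMulVec x x := by
      simp [gram, hB, add_comm, add_left_comm]
    have hm : (fun i j => B⁻¹ i j - u i * u j / (1 + x ⬝ᵥ u) : Matrix (Fin d) (Fin d) ℝ) =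
        B⁻¹ - (1 + x ⬝ᵥ u)⁻¹ • Matrix.vecMulVec u u := by
      ext i j
      simp [Matrix.vecMulVec_apply]
      ring
    have hBu : B.mulVec u = x := by
      rw [hu, Matrix.mulVec_mulVec, Matrix.mul_nonsing_inv _ hdet, Matrix.one_mulVec]
    have hxB : Matrix.vecMul x B⁻¹ = u := by
      rw [← Matrix.mulVec_transpose, hsymm]
    rw [hg, hm, Matrix.mul_sub, Matrix.add_mul, Matrix.add_mul, Matrix.mul_nonsing_inv _ hdet,
      Matrix.mul_smul, Matrix.mul_smul, Matrix.mul_vecMulVec, hBu, Matrix.vecMulVec_mul, hxB,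
      Matrix.vecMulVec_mul_vecMulVec]
    ext i j
    have : (1 + x ⬝ᵥ u) ≠ 0 := by positivity
    simp [Matrix.vecMulVec_apply]
    field_simp
    ring

end InvGram

/-! ### The interaction -/

/-- One outcome of all the randomness of all episodes: for each episode and step, the observation
that is emitted if the latent state is `s`, and the reward that is drawn if the latent state is `s`
and the action is `a`. -/
abbrev Tape (S : Type*) (O : Type*) (A : ℕ) := (ℕ × ℕ × S → O) × (ℕ × ℕ × S × Fin A → ℝ)

namespace DetPOMDP

variable {S : Type*} {O : Type*} [MeasurableSpace O] {A : ℕ} (𝓜 : DetPOMDP S O A)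

/-- The law of the tape: all draws are independent and follow the laws of the model. -/
def tapeLaw : Measure (Tape S O A) :=
  (Measure.infinitePi fun i : ℕ × ℕ × S => 𝓜.emission i.2.1 i.2.2).prod
    (Measure.infinitePi fun i : ℕ × ℕ × S × Fin A => 𝓜.reward i.2.1 i.2.2.1 i.2.2.2)

/-- The environment that the algorithm faces: the answers are read off the tape at the latent state
that the actions played so far have led to. -/
def env {d : ℕ} (ψ : O → EuclideanSpace ℝ (Fin d)) (ω : Tape S O A) : Env A d where
  feat i l := (ψ (ω.1 (i, l.length, 𝓜.latent l))).ofLp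
  rew i l a := ω.2 (i, l.length, 𝓜.latent l, a)

end DetPOMDP

end EQDP

end

/-!
Since `G_h` has a left inverse, linearity of `Q*` in the latent features `φ` passes to the mean
observation features `𝔼 ψ`, with weights of norm at most `Θ`. The mean feature of the state reached
by an action sequence can be estimated from fresh episodes because the transitions are
deterministic. Hoeffding's inequality and a union bound over the at most `A ^ H` sequences of each
length and over all possible numbers of past episodes make every estimate that is ever formed
accurate to within `η`, with high probability.

At a covered feature, ridge regression predicts `Q*` to within `Δ / 2`, so the greedy action is
exactly optimal. The value returned by `ComputeV` is therefore a sum of at most `H` reward estimates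
along a truly optimal path: its error is at most `H η` and does not feed back through the
regression.

Each explored point is uncovered and hence decreases the trace of `Σ_h⁻¹` by at least a fixed
amount, whatever the samples are. This bounds the number of explorations on every run, and the whole
cost is amortized against the data points collected.
-/

namespace EQDP

section LinearAlgebra

open Matrix

variable {n : Type*} [Fintype n]

theorem dotProduct_sq_le (x y : n → ℝ) : (x ⬝ᵥ y) ^ 2 ≤ (x ⬝ᵥ x) * (y ⬝ᵥ y) := by
  simpa only [dotProduct, pow_two] using Finset.sum_mul_sq_le_sq_mul_sq Finset.univ x y

theorem dotProduct_mulVec_comm_of_isHermitian {B : Matrix n n ℝ} (hB : B.IsHermitian)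
    (x y : n → ℝ) : x ⬝ᵥ B *ᵥ y = y ⬝ᵥ B *ᵥ x := by
  rw [dotProduct_mulVec, ← mulVec_transpose, ← conjTranspose_eq_transpose_of_trivial, hB.eq,
    dotProduct_comm]

theorem dotProduct_mulVec_sq_le_of_posSemidef {B : Matrix n n ℝ} (hB : B.PosSemidef)
    (x y : n → ℝ) : (x ⬝ᵥ B *ᵥ y) ^ 2 ≤ (x ⬝ᵥ B *ᵥ x) * (y ⬝ᵥ B *ᵥ y) := by
  classical
  have h := LinearMap.BilinForm.apply_sq_le_of_symm (Matrix.toBilin' B)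
    (fun z => by simpa [Matrix.toBilin'_apply'] using hB.dotProduct_mulVec_nonneg z)
    ⟨fun z w => by
      simpa [Matrix.toBilin'_apply'] using dotProduct_mulVec_comm_of_isHermitian hB.isHermitian z w⟩
    x y
  simpa only [Matrix.toBilin'_apply'] using h

variable [DecidableEq n]

/-- The Sherman–Morrison formula. -/
theorem inv_add_vecMulVec {K : Type*} [Field K] {B : Matrix n n K} (hB : IsUnit B) {x y : n → K}
    (hxy : 1 + y ⬝ᵥ B⁻¹ *ᵥ x ≠ 0) :
    (B + vecMulVec x y)⁻¹ =
      B⁻¹ - (1 + y ⬝ᵥ B⁻¹ *ᵥ x)⁻¹ • vecMulVec (B⁻¹ *ᵥ x) (y ᵥ* B⁻¹) := by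
  have hdet : IsUnit B.det := (isUnit_iff_isUnit_det B).1 hB
  refine inv_eq_right_inv ?_
  rw [Matrix.mul_sub, Matrix.add_mul, Matrix.add_mul, Matrix.mul_smul, Matrix.mul_smul,
    mul_vecMulVec, vecMulVec_mul, vecMulVec_mul_vecMulVec, mulVec_mulVec,
    mul_nonsing_inv _ hdet, one_mulVec]
  ext i j
  simp only [vecMulVec_smul, Matrix.sub_apply, Matrix.add_apply, vecMulVec_apply, Matrix.smul_apply,
    smul_eq_mul]
  field_simp
  ring

theorem trace_inv_add_vecMulVec_self {B : Matrix n n ℝ} (hB : B.PosDef) (x : n → ℝ) :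
    (B + vecMulVec x x)⁻¹.trace =
      B⁻¹.trace - (B⁻¹ *ᵥ x ⬝ᵥ B⁻¹ *ᵥ x) / (1 + x ⬝ᵥ B⁻¹ *ᵥ x) := by
  have hq : 0 ≤ x ⬝ᵥ B⁻¹ *ᵥ x := by simpa using hB.inv.posSemidef.dotProduct_mulVec_nonneg x
  have hsymm : x ᵥ* B⁻¹ = B⁻¹ *ᵥ x := by
    rw [← mulVec_transpose, ← conjTranspose_eq_transpose_of_trivial, hB.inv.isHermitian.eq]
  rw [inv_add_vecMulVec hB.isUnit (by positivity), hsymm, trace_sub, trace_smul,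
    trace_vecMulVec, smul_eq_mul, inv_mul_eq_div]

/-- The potential argument: the trace of the inverse stays positive, so that only boundedly many
vectors with `B⁻¹`-norm bounded below can be added. -/
theorem trace_inv_add_vecMulVec_self_le {B : Matrix n n ℝ} (hB : B.PosDef) {x : n → ℝ} {c : ℝ}
    (hc : 0 ≤ c) (hx : x ⬝ᵥ x ≤ 1) (hcx : c ≤ x ⬝ᵥ B⁻¹ *ᵥ x) :
    (B + vecMulVec x x)⁻¹.trace + c ^ 2 / (1 + c) ≤ B⁻¹.trace := by
  set u := B⁻¹ *ᵥ x with hu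
  set q := x ⬝ᵥ u with hq
  have hqu : q ^ 2 ≤ u ⬝ᵥ u := by
    have := dotProduct_sq_le x u
    have : 0 ≤ u ⬝ᵥ u := by simpa using dotProduct_star_self_nonneg u
    nlinarith
  have hmono : c ^ 2 / (1 + c) ≤ q ^ 2 / (1 + q) := by
    rw [div_le_div_iff₀ (by positivity) (by linarith)]
    nlinarith [mul_nonneg hc (hc.trans hcx)]
  have hdiv : q ^ 2 / (1 + q) ≤ (u ⬝ᵥ u) / (1 + q) := by
    have : 0 ≤ 1 + q := by linarith
    gcongr
  rw [trace_inv_add_vecMulVec_self hB, ← hu, ← hq]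
  linarith

end LinearAlgebra

section RidgeRegression

open Matrix

variable {d : ℕ} {lam : ℝ}

theorem gram_nil : gram lam ([] : List (Vec d)) = lam • 1 := by
  simp [gram]

theorem gram_cons (x : Vec d) (l : List (Vec d)) :
    gram lam (x :: l) = gram lam l + vecMulVec x x := by
  simp [gram, add_comm, add_left_comm]

theorem gram_mulVec_cons (x : Vec d) (l : List (Vec d)) (u : Vec d) :
    gram lam (x :: l) *ᵥ u = gram lam l *ᵥ u + (x ⬝ᵥ u) • x := by
  rw [gram_cons, add_mulVec, vecMulVec_mulVec, op_smul_eq_smul]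

theorem trace_inv_gram_nil : (gram lam ([] : List (Vec d)))⁻¹.trace = d / lam := by
  rcases eq_or_ne lam 0 with rfl | h
  · simp [gram_nil]
  · have : (lam • 1 : Matrix (Fin d) (Fin d) ℝ)⁻¹ = lam⁻¹ • 1 :=
      inv_eq_right_inv (by simp [smul_smul, h])
    rw [gram_nil, this, trace_smul, trace_one, Fintype.card_fin, smul_eq_mul, inv_mul_eq_div]

theorem mul_dotProduct_self_le_gram (l : List (Vec d)) (u : Vec d) :
    lam * (u ⬝ᵥ u) ≤ u ⬝ᵥ gram lam l *ᵥ u := by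
  induction l with
  | nil => simp [gram_nil, smul_mulVec]
  | cons x l ih =>
    rw [gram_mulVec_cons, dotProduct_add, dotProduct_smul, smul_eq_mul, dotProduct_comm u x]
    linarith [mul_self_nonneg (x ⬝ᵥ u)]

theorem mul_dotProduct_inv_gram_le (hlam : 0 < lam) (l : List (Vec d)) (x : Vec d) :
    lam * (x ⬝ᵥ (gram lam l)⁻¹ *ᵥ x) ≤ x ⬝ᵥ x := by
  have hB := gram_posDef hlam l
  set u := (gram lam l)⁻¹ *ᵥ x with hu
  have hux : gram lam l *ᵥ u = x := by
    rw [hu, mulVec_mulVec, mul_nonsing_inv _ ((isUnit_iff_isUnit_det _).1 hB.isUnit), one_mulVec]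
  have hle : lam * (u ⬝ᵥ u) ≤ x ⬝ᵥ u := by
    simpa only [hux, dotProduct_comm u x] using mul_dotProduct_self_le_gram (lam := lam) l u
  have hq : 0 ≤ x ⬝ᵥ u := by simpa using hB.inv.posSemidef.dotProduct_mulVec_nonneg x
  have hx : 0 ≤ x ⬝ᵥ x := by simpa using dotProduct_star_self_nonneg x
  rcases hq.eq_or_lt with hzero | hpos
  · rwa [← hzero, mul_zero]
  · refine le_of_mul_le_mul_right ?_ hpos
    calc lam * (x ⬝ᵥ u) * (x ⬝ᵥ u) = lam * (x ⬝ᵥ u) ^ 2 := by ring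
      _ ≤ lam * ((x ⬝ᵥ x) * (u ⬝ᵥ u)) := by gcongr; exact dotProduct_sq_le x u
      _ = (x ⬝ᵥ x) * (lam * (u ⬝ᵥ u)) := by ring
      _ ≤ (x ⬝ᵥ x) * (x ⬝ᵥ u) := by gcongr

theorem abs_dotProduct_inv_gram_le (hlam : 0 < lam) (l : List (Vec d)) {x y : Vec d} {ε c : ℝ}
    (hε : 0 ≤ ε) (hc : 0 ≤ c) (hx : x ⬝ᵥ (gram lam l)⁻¹ *ᵥ x ≤ ε ^ 2) (hy : y ⬝ᵥ y ≤ c ^ 2) :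
    |y ⬝ᵥ (gram lam l)⁻¹ *ᵥ x| ≤ ε * c / √lam := by
  have hB := (gram_posDef hlam l).inv.posSemidef
  have hyy : y ⬝ᵥ (gram lam l)⁻¹ *ᵥ y ≤ c ^ 2 / lam := by
    rw [le_div_iff₀' hlam]
    exact (mul_dotProduct_inv_gram_le hlam l y).trans hy
  have hxx : 0 ≤ x ⬝ᵥ (gram lam l)⁻¹ *ᵥ x := by simpa using hB.dotProduct_mulVec_nonneg x
  refine abs_le_of_sq_le_sq ?_ (by positivity)
  calc (y ⬝ᵥ (gram lam l)⁻¹ *ᵥ x) ^ 2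
      ≤ (y ⬝ᵥ (gram lam l)⁻¹ *ᵥ y) * (x ⬝ᵥ (gram lam l)⁻¹ *ᵥ x) :=
        dotProduct_mulVec_sq_le_of_posSemidef hB y x
    _ ≤ c ^ 2 / lam * ε ^ 2 := by gcongr
    _ = (ε * c / √lam) ^ 2 := by rw [div_pow, mul_pow, Real.sq_sqrt hlam.le]; ring

/-- The vector `∑ y x` over a list of pairs `(x, y)`. -/
def momentSum (L : List (Vec d × ℝ)) : Vec d := (L.map fun z => z.2 • z.1).sum

theorem momentSum_cons (z : Vec d × ℝ) (L : List (Vec d × ℝ)) :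
    momentSum (z :: L) = z.2 • z.1 + momentSum L := by
  simp [momentSum]

/-- The ridge regression estimate `Σ⁻¹ ∑ y x`, where `Σ` is the regularized Gram matrix of `F` and
the sum is over the pairs `(x, y)` in `L`. -/
noncomputable def ridgeEstimate (lam : ℝ) (F : List (Vec d)) (L : List (Vec d × ℝ)) : Vec d :=
  (gram lam F)⁻¹ *ᵥ momentSum L

theorem abs_dotProduct_momentSum_sub_gram_le (L : List (Vec d × ℝ)) (θ b : Vec d) {ζ c : ℝ}
    (hL : ∀ z ∈ L, |z.2 - θ ⬝ᵥ z.1| ≤ ζ) (hb : ∀ z ∈ L, |z.1 ⬝ᵥ b| ≤ c) :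
    |b ⬝ᵥ momentSum L - b ⬝ᵥ (gram lam (L.map Prod.fst) *ᵥ θ - lam • θ)| ≤ L.length * (ζ * c) := by
  induction L with
  | nil => simp [momentSum, gram_nil, smul_mulVec]
  | cons z L ih =>
    obtain ⟨⟨hzL, hL⟩, hzb, hb⟩ := And.intro (List.forall_mem_cons.1 hL) (List.forall_mem_cons.1 hb)
    have hz : |(z.2 - θ ⬝ᵥ z.1) * (z.1 ⬝ᵥ b)| ≤ ζ * c := by
      rw [abs_mul]
      exact mul_le_mul hzL hzb (abs_nonneg _) ((abs_nonneg _).trans hzL)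
    have hsplit : b ⬝ᵥ momentSum (z :: L) -
        b ⬝ᵥ (gram lam ((z :: L).map Prod.fst) *ᵥ θ - lam • θ) =
        (b ⬝ᵥ momentSum L - b ⬝ᵥ (gram lam (L.map Prod.fst) *ᵥ θ - lam • θ)) +
          (z.2 - θ ⬝ᵥ z.1) * (z.1 ⬝ᵥ b) := by
      rw [List.map_cons, gram_mulVec_cons, momentSum_cons]
      simp only [dotProduct_add, dotProduct_sub, dotProduct_smul, smul_eq_mul,
        dotProduct_comm z.1 θ, dotProduct_comm z.1 b]
      ring
    rw [hsplit, List.length_cons, Nat.cast_add_one, add_one_mul]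
    exact (abs_add_le _ _).trans (add_le_add (ih hL hb) hz)

/-- The first term of the bound is the bias of the regularization, the second one the accumulated
error of the labels. -/
theorem abs_ridgeEstimate_sub_le (hlam : 0 < lam) (L : List (Vec d × ℝ)) (θ x : Vec d)
    {ζ ε Θ : ℝ} (hε : 0 ≤ ε) (hΘ : 0 ≤ Θ) (hθ : θ ⬝ᵥ θ ≤ Θ ^ 2)
    (hL₁ : ∀ z ∈ L, z.1 ⬝ᵥ z.1 ≤ 1) (hL : ∀ z ∈ L, |z.2 - θ ⬝ᵥ z.1| ≤ ζ)
    (hx : x ⬝ᵥ (gram lam (L.map Prod.fst))⁻¹ *ᵥ x ≤ ε ^ 2) :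
    |ridgeEstimate lam (L.map Prod.fst) L ⬝ᵥ x - θ ⬝ᵥ x| ≤
      √lam * ε * Θ + L.length * (ζ * (ε / √lam)) := by
  set F := L.map Prod.fst with hF
  have hB := gram_posDef hlam F
  set b := (gram lam F)⁻¹ *ᵥ x with hb
  have hlabels := abs_dotProduct_momentSum_sub_gram_le (lam := lam) (c := ε / √lam) L θ b hL
    fun z hz => by
      simpa using abs_dotProduct_inv_gram_le hlam F hε zero_le_one hx (by simpa using hL₁ z hz)
  have hbias : |lam * (θ ⬝ᵥ b)| ≤ √lam * ε * Θ := by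
    have hlam' : lam = √lam * √lam := (Real.mul_self_sqrt hlam.le).symm
    calc |lam * (θ ⬝ᵥ b)| ≤ lam * (ε * Θ / √lam) := by
          rw [abs_mul, abs_of_pos hlam]
          gcongr
          exact abs_dotProduct_inv_gram_le hlam F hε hΘ hx hθ
      _ = √lam * ε * Θ := by
          nth_rewrite 1 [hlam']
          field_simp
  have hest : ridgeEstimate lam F L ⬝ᵥ x = b ⬝ᵥ momentSum L := by
    rw [ridgeEstimate, dotProduct_comm, dotProduct_mulVec_comm_of_isHermitian hB.inv.isHermitian,
      dotProduct_comm]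
  have hgram : b ⬝ᵥ gram lam F *ᵥ θ = θ ⬝ᵥ x := by
    rw [dotProduct_mulVec_comm_of_isHermitian hB.isHermitian, hb, mulVec_mulVec,
      mul_nonsing_inv _ ((isUnit_iff_isUnit_det _).1 hB.isUnit), one_mulVec]
  rw [← hF, dotProduct_sub, hgram, dotProduct_smul, smul_eq_mul, dotProduct_comm b θ] at hlabels
  rw [hest]
  calc |b ⬝ᵥ momentSum L - θ ⬝ᵥ x|
      = |-(lam * (θ ⬝ᵥ b)) + (b ⬝ᵥ momentSum L - (θ ⬝ᵥ x - lam * (θ ⬝ᵥ b)))| := by congr 1; ring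
    _ ≤ |-(lam * (θ ⬝ᵥ b))| + |b ⬝ᵥ momentSum L - (θ ⬝ᵥ x - lam * (θ ⬝ᵥ b))| := abs_add_le _ _
    _ ≤ _ := by rw [abs_neg]; exact add_le_add hbias hlabels

end RidgeRegression

section SingularValues

open Module

theorem singularValue_mul_norm_le {𝕜 E F : Type*} [RCLike 𝕜]
    [NormedAddCommGroup E] [InnerProductSpace 𝕜 E] [FiniteDimensional 𝕜 E]
    [NormedAddCommGroup F] [InnerProductSpace 𝕜 F] [FiniteDimensional 𝕜 F]
    (T : E →ₗ[𝕜] F) (v : E) : T.singularValues (finrank 𝕜 E - 1) * ‖v‖ ≤ ‖T v‖ := by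
  have hsymm := T.isSymmetric_adjoint_comp_self
  set b := hsymm.eigenvectorBasis rfl
  have hT : ‖T v‖ ^ 2 = ∑ i : Fin (finrank 𝕜 E),
      T.singularValues i ^ 2 * ‖inner 𝕜 (b i) v‖ ^ 2 := by
    have h : inner 𝕜 v ((LinearMap.adjoint T ∘ₗ T) v) = ((‖T v‖ ^ 2 : ℝ) : 𝕜) := by
      rw [LinearMap.comp_apply, LinearMap.adjoint_inner_right, inner_self_eq_norm_sq_to_K]
      norm_cast
    rw [← RCLike.ofReal_inj (K := 𝕜), ← h, ← b.sum_inner_mul_inner]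
    push_cast
    refine Finset.sum_congr rfl fun i _ => ?_
    rw [← LinearMap.coe_comp, ← hsymm (b i) v, hsymm.apply_eigenvectorBasis, inner_smul_left,
      RCLike.conj_ofReal, ← T.sq_singularValues_fin rfl i, ← inner_conj_symm v (b i),
      ← RCLike.conj_mul]
    push_cast
    ring
  refine le_of_sq_le_sq ?_ (norm_nonneg _)
  rw [mul_pow, hT, ← b.sum_sq_norm_inner_right v, Finset.mul_sum]
  gcongr with i
  · exact T.singularValues_nonneg _
  · exact T.singularValues_antitone (by omega)

theorem exists_inner_map_eq_inner {𝕜 E F : Type*} [RCLike 𝕜]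
    [NormedAddCommGroup E] [InnerProductSpace 𝕜 E] [FiniteDimensional 𝕜 E]
    [NormedAddCommGroup F] [InnerProductSpace 𝕜 F] [FiniteDimensional 𝕜 F]
    {T : E →ₗ[𝕜] F} {c : ℝ} (hc : 0 < c) (hT : ∀ v, c * ‖v‖ ≤ ‖T v‖) (w : E) :
    ∃ θ : F, ‖θ‖ ≤ ‖w‖ / c ∧ ∀ v, inner 𝕜 θ (T v) = inner 𝕜 w v := by
  have hinj : Function.Injective (LinearMap.adjoint T ∘ₗ T) := by
    rw [injective_iff_map_eq_zero]
    intro u hu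
    have hTu : inner 𝕜 (T u) (T u) = 0 := by
      rw [← LinearMap.adjoint_inner_right, ← LinearMap.comp_apply, hu, inner_zero_right]
    have hle := hT u
    rw [inner_self_eq_zero.1 hTu, norm_zero] at hle
    exact norm_le_zero_iff.1 (nonpos_of_mul_nonpos_right hle hc)
  obtain ⟨u, hu⟩ := LinearMap.injective_iff_surjective.1 hinj w
  refine ⟨T u, ?_, fun v => ?_⟩
  · have hTu : ‖T u‖ * ‖T u‖ ≤ ‖u‖ * ‖w‖ := by
      rw [← inner_self_eq_norm_mul_norm (𝕜 := 𝕜), ← LinearMap.adjoint_inner_right,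
        ← LinearMap.comp_apply, hu]
      exact re_inner_le_norm u w
    rw [le_div_iff₀ hc]
    rcases (norm_nonneg (T u)).eq_or_lt with hzero | hpos
    · simp [← hzero]
    · refine le_of_mul_le_mul_left ?_ hpos
      calc ‖T u‖ * (‖T u‖ * c) = c * (‖T u‖ * ‖T u‖) := by ring
        _ ≤ c * (‖u‖ * ‖w‖) := by gcongr
        _ = c * ‖u‖ * ‖w‖ := by ring
        _ ≤ ‖T u‖ * ‖w‖ := by gcongr; exact hT u
  · rw [← hu]
    exact (LinearMap.adjoint_inner_left T v (T u)).symm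

variable {d dₛ : ℕ}

theorem minSingularValue_mul_norm_le (G : Matrix (Fin d) (Fin dₛ) ℝ)
    (v : EuclideanSpace ℝ (Fin dₛ)) :
    minSingularValue G * ‖v‖ ≤ ‖Matrix.toEuclideanLin G v‖ := by
  simpa [minSingularValue] using singularValue_mul_norm_le (Matrix.toEuclideanLin G) v

theorem minSingularValue_pos (hdₛ : 0 < dₛ) {G : Matrix (Fin d) (Fin dₛ) ℝ}
    {L : Matrix (Fin dₛ) (Fin d) ℝ} (hL : L * G = 1) : 0 < minSingularValue G := by
  have hinj : Function.Injective (Matrix.toEuclideanLin G) := by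
    refine Function.LeftInverse.injective (g := Matrix.toEuclideanLin L) fun v => ?_
    simp [Matrix.toLpLin_apply, Matrix.mulVec_mulVec, hL]
  refine (LinearMap.injective_iff_forall_lt_finrank_singularValues_pos _).1 hinj _ ?_
  simpa using hdₛ

end SingularValues

section Semantics

variable {A d : ℕ} {α β : Type}

/-- The weakest precondition: the postcondition `Q` holds for the result and the final machine of
the run of `p` from `m`. -/
def wp (p : Prog A d α) (m : Machine A d) (Q : α → Machine A d → Prop) : Prop :=
  Q (p.run m).1 (p.run m).2

section Rules

variable {m : Machine A d} {Q : α → Machine A d → Prop} {p : Prog A d α}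

theorem wp_pure {x : α} (h : Q x m) : wp (pure x) m Q := h

theorem wp_bind {R : β → Machine A d → Prop} {f : α → Prog A d β}
    (h : wp p m fun x m' => wp (f x) m' R) : wp (p >>= f) m R := h

theorem wp.mono {Q' : α → Machine A d → Prop} (h : wp p m Q) (hQ : ∀ x m', Q x m' → Q' x m') :
    wp p m Q' := hQ _ _ h

theorem wp_get_bind {f : Machine A d → Prog A d α} (h : wp (f m) m Q) : wp (get >>= f) m Q := h

theorem wp_tabulate {n : ℕ} {f : Fin n → Prog A d α} (J : ℕ → (Fin n → α) → Machine A d → Prop)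
    (hf : ∀ (i : Fin n) v m, J i v m →
      wp (f i) m fun y m' => J (i + 1) (Function.update v i y) m')
    (v : Fin n → α) {m : Machine A d} (h0 : J 0 v m) : wp (tabulate n f) m (J n) := by
  induction n generalizing m with
  | zero => rwa [Subsingleton.elim v Fin.elim0] at h0
  | succ n ih =>
    refine wp_bind ((hf 0 v m h0).mono fun y m₁ hy => wp_bind ?_)
    refine ih (f := fun i => f i.succ) (fun i w => J (i + 1) (Fin.cons y w)) (fun i w m' hw => ?_)
      (fun i => v i.succ) ?_
    · simpa [Fin.cons_update] using hf i.succ (Fin.cons y w) m' (by simpa using hw)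
    · have hcons : Fin.cons y (fun i => v i.succ) = Function.update v 0 y := by
        ext i; refine Fin.cases ?_ (fun j => ?_) i <;> simp
      simpa only [hcons, Fin.val_zero] using hy

end Rules

/-- The machine after `k` further elementary operations. -/
def Machine.tick (m : Machine A d) (k : ℕ) : Machine A d := { m with steps := m.steps + k }

theorem Machine.tick_tick (m : Machine A d) (k l : ℕ) : (m.tick k).tick l = m.tick (k + l) := by
  simp [Machine.tick, add_assoc]

/-- From whatever machine it is started, the program `p` returns `v`, and its only effect is to
perform at most `c` elementary operations. -/
def Computes (p : Prog A d α) (v : α) (c : ℕ) : Prop :=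
  ∀ m, (p.run m).1 = v ∧ ∃ k ≤ c, (p.run m).2 = m.tick k

namespace Computes

variable {p : Prog A d α} {v : α} {c c' : ℕ}

theorem mono (h : Computes p v c) (hc : c ≤ c') : Computes p v c' := fun m =>
  ⟨(h m).1, (h m).2.imp fun _ hk => ⟨hk.1.trans hc, hk.2⟩⟩

theorem congr_value {v' : α} (h : Computes p v c) (hv : ∀ m, (p.run m).1 = v') :
    Computes p v' c := fun m => ⟨hv m, (h m).2⟩

theorem pure (v : α) : Computes (pure v : Prog A d α) v 0 := fun _ => ⟨rfl, 0, le_rfl, rfl⟩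

theorem bind {f : α → Prog A d β} {w : β} (hp : Computes p v c) (hf : Computes (f v) w c') :
    Computes (p >>= f) w (c + c') := by
  intro m
  obtain ⟨rfl, k, hk, hm⟩ := hp m
  obtain ⟨hw, k', hk', hm'⟩ := hf (p.run m).2
  refine ⟨hw, k + k', add_le_add hk hk', ?_⟩
  rw [← Machine.tick_tick, ← hm]
  exact hm'

end Computes

theorem computes_add (x y : ℝ) : Computes (add x y : Prog A d ℝ) (x + y) 1 :=
  fun _ => ⟨rfl, 1, le_rfl, rfl⟩

theorem computes_sub (x y : ℝ) : Computes (sub x y : Prog A d ℝ) (x - y) 1 :=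
  fun _ => ⟨rfl, 1, le_rfl, rfl⟩

theorem computes_mul (x y : ℝ) : Computes (mul x y : Prog A d ℝ) (x * y) 1 :=
  fun _ => ⟨rfl, 1, le_rfl, rfl⟩

theorem computes_div (x y : ℝ) : Computes (div x y : Prog A d ℝ) (x / y) 1 :=
  fun _ => ⟨rfl, 1, le_rfl, rfl⟩

theorem computes_le (x y : ℝ) : Computes (le x y : Prog A d Bool) (decide (x ≤ y)) 1 :=
  fun _ => ⟨rfl, 1, le_rfl, rfl⟩

theorem computes_tabulate {n c : ℕ} {f : Fin n → Prog A d α} {v : Fin n → α}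
    (hf : ∀ i, Computes (f i) (v i) c) : Computes (tabulate n f) v (n * c) := by
  induction n with
  | zero => rw [Nat.zero_mul, Subsingleton.elim v Fin.elim0]; exact .pure _
  | succ n ih =>
    rw [← Fin.cons_self_tail v, Nat.succ_mul, Nat.add_comm (n * c)]
    exact .bind (hf 0) (c' := n * c + 0) (.bind (ih fun i => hf i.succ) (.pure _))

theorem computes_sumUp {n c : ℕ} {f : Fin n → Prog A d ℝ} {v : Fin n → ℝ}
    (hf : ∀ i, Computes (f i) (v i) c) : Computes (sumUp n f) (∑ i, v i) (n * (c + 1)) := by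
  induction n with
  | zero => rw [Fin.sum_univ_zero, Nat.zero_mul]; exact .pure 0
  | succ n ih =>
    rw [Fin.sum_univ_castSucc, Nat.succ_mul]
    exact .bind (ih fun i => hf i.castSucc) (.bind (hf _) (computes_add _ _))

theorem computes_vecAdd (x y : Vec d) : Computes (vecAdd x y : Prog A d (Vec d)) (x + y) d :=
  (computes_tabulate fun i => computes_add (x i) (y i)).mono (mul_one d).le

theorem computes_dot (x y : Vec d) : Computes (dot x y : Prog A d ℝ) (x ⬝ᵥ y) (d * 2) :=
  computes_sumUp fun i => computes_mul (x i) (y i)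

theorem computes_matVec (P : Fin d → Vec d) (x : Vec d) :
    Computes (matVec P x : Prog A d (Vec d)) (Matrix.of P |>.mulVec x) (d * (d * 2)) :=
  computes_tabulate fun i => computes_dot (P i) x

end Semantics

section Costs

variable {R : Type*} [CommSemiring R]

/-- Bound for the cost of the inverse of a Gram matrix of `n` vectors. The costs are stated over
an arbitrary commutative semiring, so that they are at once numbers of operations and
polynomials. -/
def inverseCost (d n : R) : R := d * d + n * (d * (d * 5) + d * 2 + 1)

/-- Bound for the cost of a coverage test with `n` vectors. -/
def coverCost (d n : R) : R := inverseCost d n + (d * (d * 2) + (d * 2 + 2))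

/-- Bound for the cost of a greedy choice with `n` vectors. -/
def greedyCost (A d n : R) : R :=
  A * (inverseCost d n + (n * (d * 2) + (d * (d * 2) + d * 2))) + A

/-- Bound for the cost of a mean of `M` samples. -/
def sampleCost (H d M : R) : R := M * (H * (d + 2) + 2 * d + 4) + d + 1

/-- Bound for the cost of one call of the value subroutine, apart from further calls, with
datasets of size at most `N`. -/
def nodeCost (H A d M N : R) : R :=
  2 * sampleCost H d M + coverCost d N + greedyCost A d N + A * sampleCost H d M + A + 1

/-- Bound for the cost of an estimate of an action value, with `k` steps to go after the action. -/
def actionCost (H A d M N k : R) : R := sampleCost H d M + nodeCost H A d M N * k + 1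

/-- Bound for the cost of a new data point. -/
def pointCost (H A d M N : R) : R := A * actionCost H A d M N H

/-- Bound for the cost of a round of the main loop, apart from the exploration. -/
def roundCost (H A d M N : R) : R :=
  H * (sampleCost H d M + greedyCost A d N) + H * coverCost d N

/-- Bound for the total cost of the algorithm: each round but the last one adds a data point. -/
def totalCost (H A d M N : R) : R :=
  roundCost H A d M N + (pointCost H A d M N + roundCost H A d M N) * (H * N)

end Costs

section Estimators

variable {A d : ℕ}

theorem computes_invGram {lam : ℝ} (hlam : 0 < lam) (l : List (Vec d)) :
    Computes (invGram lam l : Prog A d (Fin d → Vec d))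
      ((gram lam l)⁻¹ : Matrix (Fin d) (Fin d) ℝ) (inverseCost d l.length) := by
  induction l with
  | nil =>
    have hentry (i j : Fin d) : Computes (if i = j then div 1 lam else pure 0 : Prog A d ℝ)
        (if i = j then 1 / lam else 0) 1 := by
      split_ifs
      exacts [computes_div 1 lam, (Computes.pure 0).mono zero_le_one]
    have h : Computes (invGram lam [] : Prog A d _) _ _ :=
      computes_tabulate fun i => computes_tabulate fun j => hentry i j
    exact (h.congr_value (invGram_eq hlam [])).mono (by simp [inverseCost])
  | cons x l ih =>
    have h : Computes (invGram lam (x :: l) : Prog A d _) _ _ :=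
      .bind ih <| .bind (computes_matVec _ x) <| .bind (computes_dot x _) <|
        .bind (computes_add 1 _) <| computes_tabulate fun i => computes_tabulate fun j =>
          .bind (computes_mul _ _) <| .bind (computes_div _ _) (computes_sub _ _)
    refine (h.congr_value (invGram_eq hlam (x :: l))).mono (le_of_eq ?_)
    simp only [inverseCost, List.length_cons]
    ring

theorem computes_moment (L : List (Vec d × ℝ)) :
    Computes (moment L : Prog A d (Vec d)) (momentSum L) (L.length * (d * 2)) := by
  induction L with
  | nil => exact (Computes.pure 0).mono (Nat.zero_le _)
  | cons z L ih =>
    have hz : momentSum (z :: L) = momentSum L + fun i => z.1 i * z.2 := by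
      rw [momentSum_cons, add_comm]
      congr 1
      ext i
      simp [mul_comm]
    rw [hz, List.length_cons]
    exact .mono (.bind ih <| .bind (computes_tabulate fun i => computes_mul (z.1 i) z.2) <|
      computes_vecAdd _ _) (le_of_eq (by ring))

/-- A run from `m` to `m'` of cost at most `c` that leaves the datasets unchanged. -/
structure PureRun (c : ℕ) (m m' : Machine A d) : Prop where
  feats : m'.feats = m.feats
  pairs : m'.pairs = m.pairs
  episode_le : m.episode ≤ m'.episode
  episode_add_steps_le : m'.episode + m.steps ≤ m.episode + m'.steps
  steps_le : m'.steps ≤ m.steps + c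

namespace PureRun

variable {c c' : ℕ} {m m' m'' : Machine A d}

theorem refl (m : Machine A d) : PureRun 0 m m := ⟨rfl, rfl, le_rfl, le_rfl, le_rfl⟩

theorem trans (h : PureRun c m m') (h' : PureRun c' m' m'') : PureRun (c + c') m m'' where
  feats := h'.feats.trans h.feats
  pairs := h'.pairs.trans h.pairs
  episode_le := h.episode_le.trans h'.episode_le
  episode_add_steps_le := by have := h.episode_add_steps_le; have := h'.episode_add_steps_le; omega
  steps_le := by have := h.steps_le; have := h'.steps_le; omega

theorem mono (h : PureRun c m m') (hc : c ≤ c') : PureRun c' m m' :=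
  ⟨h.feats, h.pairs, h.episode_le, h.episode_add_steps_le, h.steps_le.trans (by omega)⟩

end PureRun

theorem Computes.wp {α : Type} {p : Prog A d α} {v : α} {c : ℕ} (h : Computes p v c)
    (m : Machine A d) :
    EQDP.wp p m fun x m' => x = v ∧ m'.episode = m.episode ∧ PureRun c m m' := by
  obtain ⟨hv, k, hk, hm⟩ := h m
  unfold EQDP.wp
  rw [hm]
  exact ⟨hv, rfl, rfl, rfl, le_rfl, by simp only [Machine.tick]; omega,
    Nat.add_le_add_left hk m.steps⟩

/-- The vector `x` is covered by the dataset `F`. -/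
def Covered (lam ε : ℝ) (F : List (Vec d)) (x : Vec d) : Prop :=
  x ⬝ᵥ (gram lam F)⁻¹.mulVec x ≤ ε ^ 2

theorem wp_covered {p : Params} (hlam : 0 < p.lam) (h : ℕ) (x : Vec d) (m : Machine A d) :
    wp (covered p h x) m fun b m' => (b = true ↔ Covered p.lam p.ε (m.feats h) x) ∧
      PureRun (coverCost d (m.feats h).length) m m' := by
  refine wp_get_bind (((Computes.bind (computes_invGram hlam _) <|
    .bind (computes_matVec _ x) <| .bind (computes_dot x _) <| .bind (computes_mul p.ε p.ε) <|
      computes_le _ _).wp m).mono ?_)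
  rintro b m' ⟨rfl, -, hrun⟩
  exact ⟨by rw [decide_eq_true_iff, ← pow_two]; rfl, hrun⟩

theorem wp_argmaxFrom (v : Fin A → ℝ) (l : List (Fin A)) (b : Fin A) (m : Machine A d) :
    wp (argmaxFrom v l b) m fun c m' => v b ≤ v c ∧ (∀ a ∈ l, v a ≤ v c) ∧
      PureRun l.length m m' := by
  induction l generalizing b m with
  | nil => exact ⟨le_rfl, by simp, .refl m⟩
  | cons a l ih =>
    refine wp_bind (((computes_le (v a) (v b)).wp m).mono ?_)
    rintro _ m₁ ⟨rfl, -, h₁⟩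
    by_cases hab : v a ≤ v b
    · rw [if_pos (by simpa using hab)]
      refine (ih b m₁).mono fun c m' ⟨hb, hl, h⟩ =>
        ⟨hb, ?_, (h₁.trans h).mono (by rw [List.length_cons]; omega)⟩
      exact List.forall_mem_cons.2 ⟨hab.trans hb, hl⟩
    · rw [if_neg (by simpa using hab)]
      refine (ih a m₁).mono fun c m' ⟨ha, hl, h⟩ =>
        ⟨(not_le.1 hab).le.trans ha, ?_, (h₁.trans h).mono (by rw [List.length_cons]; omega)⟩
      exact List.forall_mem_cons.2 ⟨ha, hl⟩

theorem wp_argmax [NeZero A] (v : Fin A → ℝ) (m : Machine A d) :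
    wp (argmax v) m fun b m' => (∀ a, v a ≤ v b) ∧ PureRun A m m' :=
  (wp_argmaxFrom v (List.finRange A) 0 m).mono fun _ _ h =>
    ⟨fun a => h.2.1 a (List.mem_finRange a), h.2.2.mono (by simp)⟩

theorem wp_greedy [NeZero A] {p : Params} (hlam : 0 < p.lam) {h : ℕ} (x : Vec d)
    {m : Machine A d} (hm : ∀ a, (m.pairs a h).map Prod.fst = m.feats h) :
    wp (greedy p h x) m fun b m' =>
      (∀ a, ridgeEstimate p.lam (m.feats h) (m.pairs a h) ⬝ᵥ x ≤
        ridgeEstimate p.lam (m.feats h) (m.pairs b h) ⬝ᵥ x) ∧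
      PureRun (greedyCost A d (m.feats h).length) m m' := by
  have hlen (a : Fin A) : (m.pairs a h).length = (m.feats h).length := by
    rw [← hm a, List.length_map]
  have hprediction (a : Fin A) : Computes (A := A) (do
      let P ← invGram p.lam (m.feats h)
      let b ← moment (m.pairs a h)
      let θ ← matVec P b
      dot θ x) (ridgeEstimate p.lam (m.feats h) (m.pairs a h) ⬝ᵥ x) _ :=
    .bind (computes_invGram hlam (m.feats h)) <|
      .bind ((computes_moment (m.pairs a h)).mono (by rw [hlen a])) <|
        .bind (computes_matVec _ _) (computes_dot _ x)
  refine wp_get_bind (wp_bind (((computes_tabulate hprediction).wp m).mono ?_))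
  rintro _ m₁ ⟨rfl, -, h₁⟩
  exact (wp_argmax _ m₁).mono fun b m' h₂ => ⟨h₂.1, h₁.trans h₂.2⟩

end Estimators

section Sampling

variable {A d : ℕ} (E : Env A d)

theorem wp_reset (m : Machine A d) :
    wp reset m fun _ m' => m'.played = [] ∧ m'.episode = m.episode + 1 ∧ PureRun 1 m m' :=
  ⟨rfl, rfl, rfl, rfl, Nat.le_succ _, (Nat.succ_add_eq_add_succ _ _).le, le_rfl⟩

theorem wp_observe (m : Machine A d) :
    wp (observe E) m fun x m' => x = E.feat m.episode m.played ∧ m'.played = m.played ∧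
      m'.episode = m.episode ∧ PureRun (1 + d) m m' :=
  ⟨rfl, rfl, rfl, rfl, rfl, le_rfl, Nat.add_le_add_left (Nat.le_add_right _ _) _, le_rfl⟩

theorem wp_act (a : Fin A) (m : Machine A d) :
    wp (act E a) m fun x m' => x = E.rew m.episode m.played a ∧ m'.played = m.played ++ [a] ∧
      m'.episode = m.episode ∧ PureRun 1 m m' :=
  ⟨rfl, rfl, rfl, rfl, rfl, le_rfl, Nat.add_le_add_left (Nat.le_add_right _ _) _, le_rfl⟩

theorem wp_execute (l : List (Fin A)) (m : Machine A d) :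
    wp (execute E l) m fun _ m' => m'.played = m.played ++ l ∧ m'.episode = m.episode ∧
      PureRun (l.length * (d + 2)) m m' := by
  induction l generalizing m with
  | nil => exact ⟨(List.append_nil _).symm, rfl, (PureRun.refl m).mono (Nat.zero_le _)⟩
  | cons a l ih =>
    refine wp_bind ((wp_observe E m).mono fun _ m₁ ⟨_, hp₁, he₁, h₁⟩ => ?_)
    refine wp_bind ((wp_act E a m₁).mono fun _ m₂ ⟨_, hp₂, he₂, h₂⟩ => ?_)
    refine (ih m₂).mono fun _ m₃ ⟨hp₃, he₃, h₃⟩ => ⟨?_, he₃.trans (he₂.trans he₁), ?_⟩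
    · rw [hp₃, hp₂, hp₁, List.append_assoc, List.singleton_append]
    · exact ((h₁.trans h₂).trans h₃).mono (le_of_eq (by rw [List.length_cons]; ring))

theorem wp_reset_execute_bind {α : Type} {f : Unit → Prog A d α} {l : List (Fin A)}
    {m : Machine A d} {Q : α → Machine A d → Prop}
    (hf : ∀ m', m'.played = l → m'.episode = m.episode + 1 →
      PureRun (l.length * (d + 2) + 1) m m' → wp (f ()) m' Q) :
    wp (reset >>= fun _ => execute E l >>= f) m Q := by
  refine wp_bind ((wp_reset m).mono fun _ m₁ ⟨hp₁, he₁, h₁⟩ => wp_bind ?_)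
  refine (wp_execute E l m₁).mono fun _ m₂ ⟨hp₂, he₂, h₂⟩ => hf m₂ ?_ (he₂.trans he₁) ?_
  · rw [hp₂, hp₁, List.nil_append]
  · exact (h₁.trans h₂).mono (Nat.add_comm _ _).le

/-- The mean of the features observed after the actions `l` in the `M` episodes that follow
episode `e`. -/
noncomputable def empiricalFeature (M e : ℕ) (l : List (Fin A)) : Vec d :=
  fun i => (∑ j ∈ Finset.range M, E.feat (e + 1 + j) l i) / M

/-- The mean of the rewards of the action `a` after the actions `l` in the `M` episodes that
follow episode `e`. -/
noncomputable def empiricalReward (M e : ℕ) (l : List (Fin A)) (a : Fin A) : ℝ :=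
  (∑ j ∈ Finset.range M, E.rew (e + 1 + j) l a) / M

theorem wp_featureSum (l : List (Fin A)) (n : ℕ) (m : Machine A d) :
    wp (featureSum E l n) m fun v m' =>
      v = ∑ j ∈ Finset.range n, E.feat (m.episode + 1 + j) l ∧ m'.episode = m.episode + n ∧
        PureRun (n * (l.length * (d + 2) + 2 * d + 2)) m m' := by
  induction n with
  | zero => exact ⟨rfl, rfl, (PureRun.refl m).mono (Nat.zero_le _)⟩
  | succ n ih =>
    refine wp_bind (ih.mono ?_)
    rintro _ m₁ ⟨rfl, he₁, h₁⟩
    refine wp_reset_execute_bind E fun m₂ hp₂ he₂ h₂ => ?_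
    refine wp_bind ((wp_observe E m₂).mono ?_)
    rintro _ m₃ ⟨rfl, -, he₃, h₃⟩
    refine ((computes_vecAdd _ _).wp m₃).mono ?_
    rintro _ m₄ ⟨rfl, he₄, h₄⟩
    refine ⟨?_, by omega, (((h₁.trans h₂).trans h₃).trans h₄).mono (le_of_eq (by ring))⟩
    rw [Finset.sum_range_succ, hp₂, he₂, he₁, Nat.add_right_comm]

theorem wp_featureMean {H : ℕ} {l : List (Fin A)} (hl : l.length ≤ H) (M : ℕ)
    (m : Machine A d) :
    wp (featureMean E M l) m fun x m' =>
      x = empiricalFeature E M m.episode l ∧ m'.episode = m.episode + M ∧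
        PureRun (sampleCost H d M) m m' := by
  refine wp_bind ((wp_featureSum E l M m).mono ?_)
  rintro _ m₁ ⟨rfl, he₁, h₁⟩
  refine ((computes_tabulate fun i => computes_div _ (M : ℝ)).wp m₁).mono ?_
  rintro _ m₂ ⟨rfl, he₂, h₂⟩
  refine ⟨by ext i; simp [empiricalFeature], he₂.trans he₁, (h₁.trans h₂).mono ?_⟩
  have : M * (l.length * (d + 2) + 2 * d + 2) ≤ M * (H * (d + 2) + 2 * d + 4) := by gcongr; omega
  simp only [sampleCost]
  omega

theorem wp_rewardSum (l : List (Fin A)) (a : Fin A) (n : ℕ) (m : Machine A d) :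
    wp (rewardSum E l a n) m fun v m' =>
      v = ∑ j ∈ Finset.range n, E.rew (m.episode + 1 + j) l a ∧ m'.episode = m.episode + n ∧
        PureRun (n * (l.length * (d + 2) + d + 4)) m m' := by
  induction n with
  | zero => exact ⟨rfl, rfl, (PureRun.refl m).mono (Nat.zero_le _)⟩
  | succ n ih =>
    refine wp_bind (ih.mono ?_)
    rintro _ m₁ ⟨rfl, he₁, h₁⟩
    refine wp_reset_execute_bind E fun m₂ hp₂ he₂ h₂ => ?_
    refine wp_bind ((wp_observe E m₂).mono fun _ m₃ ⟨_, hp₃, he₃, h₃⟩ => ?_)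
    refine wp_bind ((wp_act E a m₃).mono ?_)
    rintro _ m₄ ⟨rfl, -, he₄, h₄⟩
    refine ((computes_add _ _).wp m₄).mono ?_
    rintro _ m₅ ⟨rfl, he₅, h₅⟩
    refine ⟨?_, by omega,
      ((((h₁.trans h₂).trans h₃).trans h₄).trans h₅).mono (le_of_eq (by ring))⟩
    rw [Finset.sum_range_succ, hp₃, hp₂, he₃, he₂, he₁, Nat.add_right_comm]

theorem wp_rewardMean {H : ℕ} {l : List (Fin A)} (hl : l.length ≤ H) (M : ℕ) (a : Fin A)
    (m : Machine A d) :
    wp (rewardMean E M l a) m fun x m' =>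
      x = empiricalReward E M m.episode l a ∧ m'.episode = m.episode + M ∧
        PureRun (sampleCost H d M) m m' := by
  refine wp_bind ((wp_rewardSum E l a M m).mono ?_)
  rintro _ m₁ ⟨rfl, he₁, h₁⟩
  refine ((computes_div _ (M : ℝ)).wp m₁).mono ?_
  rintro _ m₂ ⟨rfl, he₂, h₂⟩
  refine ⟨rfl, he₂.trans he₁, (h₁.trans h₂).mono ?_⟩
  have : M * (l.length * (d + 2) + d + 4) ≤ M * (H * (d + 2) + 2 * d + 4) := by gcongr; omega
  simp only [sampleCost]
  omega

end Sampling

/-- The quantities of a model with deterministic transitions as functions of the actions played so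
far: mean rewards `r`, optimal action values `q`, optimal values `v` and mean features `μ`, with
linear weights `θ` for the optimal action values, which have a gap `Δ`. -/
structure SeqModel (H A d : ℕ) (Θ Δ : ℝ) where
  r : List (Fin A) → Fin A → ℝ
  q : List (Fin A) → Fin A → ℝ
  v : List (Fin A) → ℝ
  μ : List (Fin A) → Vec d
  θ : Fin A → ℕ → Vec d
  q_eq : ∀ l a, l.length < H → q l a = r l a + v (l ++ [a])
  v_end : ∀ l, l.length = H → v l = 0
  q_le : ∀ l a, l.length < H → q l a ≤ v l
  exists_q_eq : ∀ l, l.length < H → ∃ a, q l a = v l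
  gap : ∀ l a, l.length < H → 0 < v l - q l a → Δ ≤ v l - q l a
  lin : ∀ l a, l.length < H → q l a = θ a l.length ⬝ᵥ μ l
  θ_le : ∀ a h, h < H → θ a h ⬝ᵥ θ a h ≤ Θ ^ 2

namespace SeqModel

variable {H A d : ℕ} {Θ Δ : ℝ} (𝓛 : SeqModel H A d Θ Δ) {l : List (Fin A)}

/-- The actions `as`, played after the actions `l`, are optimal. -/
def OptFrom : List (Fin A) → List (Fin A) → Prop
  | _, [] => True
  | l, a :: as => 𝓛.q l a = 𝓛.v l ∧ OptFrom (l ++ [a]) as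

theorem q_eq_v_of_abs_sub_lt (hl : l.length < H) {y : Fin A → ℝ} {b : Fin A}
    (hy : ∀ a, |y a - 𝓛.q l a| < Δ / 2) (hb : ∀ a, y a ≤ y b) : 𝓛.q l b = 𝓛.v l := by
  obtain ⟨a, ha⟩ := 𝓛.exists_q_eq l hl
  by_contra hne
  have hpos : 0 < 𝓛.v l - 𝓛.q l b := sub_pos.2 ((𝓛.q_le l b hl).lt_of_ne hne)
  linarith [𝓛.gap l b hl hpos, (abs_lt.1 (hy a)).1, (abs_lt.1 (hy b)).2, hb a]

theorem abs_max_sub_v_le (hl : l.length < H) {y : Fin A → ℝ} {c : ℝ} {b : Fin A}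
    (hy : ∀ a, |y a - 𝓛.q l a| ≤ c) (hb : ∀ a, y a ≤ y b) : |y b - 𝓛.v l| ≤ c := by
  obtain ⟨a, ha⟩ := 𝓛.exists_q_eq l hl
  exact abs_le.2 ⟨by linarith [(abs_le.1 (hy a)).1, hb a],
    by linarith [(abs_le.1 (hy b)).2, 𝓛.q_le l b hl]⟩

theorem abs_add_sub_q_le (hl : l.length < H) {a : Fin A} {r v c c' : ℝ}
    (hr : |r - 𝓛.r l a| ≤ c) (hv : |v - 𝓛.v (l ++ [a])| ≤ c') :
    |r + v - 𝓛.q l a| ≤ c + c' := by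
  rw [𝓛.q_eq l a hl, add_sub_add_comm]
  exact (abs_add_le _ _).trans (add_le_add hr hv)

end SeqModel

section Estimation

variable {H A d : ℕ} {Θ Δ : ℝ}

/-- All empirical means over `M` consecutive episodes up to episode `n` are accurate up to `η`. -/
def Accurate (𝓛 : SeqModel H A d Θ Δ) (E : Env A d) (M n : ℕ) (η : ℝ) : Prop :=
  ∀ e, e + M ≤ n → ∀ l, l.length < H →
    (∀ i, |empiricalFeature E M e l i - 𝓛.μ l i| ≤ η) ∧
      ∀ a, |empiricalReward E M e l a - 𝓛.r l a| ≤ η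

theorem accurate_of_lt {𝓛 : SeqModel H A d Θ Δ} {E : Env A d} {M n : ℕ} {η : ℝ} (h : n < M) :
    Accurate 𝓛 E M n η := fun e he => by omega

/-- The accuracy of the regression targets, if the empirical means are accurate up to `η`. -/
noncomputable def targetError (H d : ℕ) (Θ η : ℝ) : ℝ := (H + d * Θ) * η

/-- The parameters are such that the datasets have at most `N` entries and the greedy actions are
optimal at covered features, if the empirical means are accurate up to `η`. -/
structure IsTuned (H d : ℕ) (Θ Δ : ℝ) (p : Params) (N : ℕ) (η : ℝ) : Prop where
  M_pos : 0 < p.M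
  ε_pos : 0 < p.ε
  lam_pos : 0 < p.lam
  Θ_nonneg : 0 ≤ Θ
  η_pos : 0 < η
  size : ∀ n : ℕ, n * ((p.ε ^ 2) ^ 2 / (1 + p.ε ^ 2)) ≤ d / p.lam → n ≤ N
  precise : √p.lam * p.ε * Θ + N * (targetError H d Θ η * (p.ε / √p.lam)) + d * Θ * η < Δ / 2

theorem empiricalFeature_dotProduct_self_le_one {M : ℕ} (hM : 0 < M) {E : Env A d}
    (hE : ∀ i l, E.feat i l ⬝ᵥ E.feat i l ≤ 1) (e : ℕ) (l : List (Fin A)) :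
    empiricalFeature E M e l ⬝ᵥ empiricalFeature E M e l ≤ 1 := by
  have hM' : (0 : ℝ) < M := by exact_mod_cast hM
  have hcoord (i : Fin d) : empiricalFeature E M e l i * empiricalFeature E M e l i ≤
      (∑ j ∈ Finset.range M, E.feat (e + 1 + j) l i ^ 2) / M := by
    have hsq := sq_sum_le_card_mul_sum_sq (s := Finset.range M)
      (f := fun j => E.feat (e + 1 + j) l i)
    rw [Finset.card_range] at hsq
    rw [empiricalFeature, div_mul_div_comm, ← pow_two, mul_comm (M : ℝ),
      div_le_div_iff₀ (by positivity) hM']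
    nlinarith
  calc empiricalFeature E M e l ⬝ᵥ empiricalFeature E M e l
      ≤ ∑ i, (∑ j ∈ Finset.range M, E.feat (e + 1 + j) l i ^ 2) / M :=
        Finset.sum_le_sum fun i _ => hcoord i
    _ = (∑ j ∈ Finset.range M, E.feat (e + 1 + j) l ⬝ᵥ E.feat (e + 1 + j) l) / M := by
        rw [← Finset.sum_div, Finset.sum_comm]
        simp only [dotProduct, pow_two]
    _ ≤ (∑ _j ∈ Finset.range M, (1 : ℝ)) / M := by gcongr; exact hE _ _
    _ = 1 := by simp [hM'.ne']

theorem abs_dotProduct_le {θ z : Vec d} {η : ℝ} (hΘ : 0 ≤ Θ) (hθ : θ ⬝ᵥ θ ≤ Θ ^ 2)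
    (hz : ∀ i, |z i| ≤ η) : |θ ⬝ᵥ z| ≤ d * Θ * η := by
  have hcoord (i : Fin d) : |θ i| ≤ Θ := by
    refine abs_le_of_sq_le_sq (le_trans ?_ hθ) hΘ
    rw [pow_two]
    exact Finset.single_le_sum (f := fun i => θ i * θ i) (fun j _ => mul_self_nonneg _)
      (Finset.mem_univ i)
  calc |θ ⬝ᵥ z| ≤ ∑ i, |θ i * z i| := Finset.abs_sum_le_sum_abs _ _
    _ ≤ ∑ _i : Fin d, Θ * η := Finset.sum_le_sum fun i _ => by
        rw [abs_mul]; exact mul_le_mul (hcoord i) (hz i) (abs_nonneg _) hΘ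
    _ = d * Θ * η := by simp [mul_assoc]

end Estimation

section Runs

variable {A d : ℕ}

/-- The number of data points of the steps before `H`. -/
def dataSize (H : ℕ) (m : Machine A d) : ℕ := ∑ j ∈ Finset.range H, (m.feats j).length

/-- The datasets of the steps before `h` are the same. -/
def SameBelow (h : ℕ) (m m' : Machine A d) : Prop :=
  ∀ j < h, m'.feats j = m.feats j ∧ ∀ a, m'.pairs a j = m.pairs a j

theorem SameBelow.trans {h : ℕ} {m m' m'' : Machine A d} (h₁ : SameBelow h m m')
    (h₂ : SameBelow h m' m'') : SameBelow h m m'' := fun j hj =>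
  ⟨(h₂ j hj).1.trans (h₁ j hj).1, fun a => ((h₂ j hj).2 a).trans ((h₁ j hj).2 a)⟩

theorem PureRun.sameBelow {c : ℕ} {m m' : Machine A d} (hr : PureRun c m m') (h : ℕ) :
    SameBelow h m m' := fun j _ => ⟨by rw [hr.feats], fun a => by rw [hr.pairs]⟩

/-- A run from `m` to `m'` of amortized cost at most `c`, if each new data point pays for `K`
elementary operations. -/
structure Run (H K c : ℕ) (m m' : Machine A d) : Prop where
  episode_le : m.episode ≤ m'.episode
  episode_add_steps_le : m'.episode + m.steps ≤ m.episode + m'.steps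
  dataSize_le : dataSize H m ≤ dataSize H m'
  steps_le : m'.steps + K * dataSize H m ≤ m.steps + c + K * dataSize H m'

namespace Run

variable {H K K' c c' : ℕ} {m m' m'' : Machine A d}

theorem trans (h : Run H K c m m') (h' : Run H K c' m' m'') : Run H K (c + c') m m'' where
  episode_le := h.episode_le.trans h'.episode_le
  episode_add_steps_le := by have := h.episode_add_steps_le; have := h'.episode_add_steps_le; omega
  dataSize_le := h.dataSize_le.trans h'.dataSize_le
  steps_le := by have := h.steps_le; have := h'.steps_le; omega

theorem mono (h : Run H K c m m') (hK : K ≤ K') (hc : c ≤ c') : Run H K' c' m m' where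
  episode_le := h.episode_le
  episode_add_steps_le := h.episode_add_steps_le
  dataSize_le := h.dataSize_le
  steps_le := by nlinarith [h.steps_le, h.dataSize_le]

theorem amortize (h : Run H K c m m') (hlt : dataSize H m < dataSize H m') :
    Run H (K + c) 0 m m' where
  episode_le := h.episode_le
  episode_add_steps_le := h.episode_add_steps_le
  dataSize_le := h.dataSize_le
  steps_le := by nlinarith [h.steps_le]

end Run

theorem PureRun.run {H K c : ℕ} {m m' : Machine A d} (h : PureRun c m m') : Run H K c m m' := by
  have hsize : dataSize H m' = dataSize H m := by rw [dataSize, h.feats]; rfl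
  exact ⟨h.episode_le, h.episode_add_steps_le, hsize.ge,
    by rw [hsize]; exact Nat.add_le_add_right h.steps_le _⟩

end Runs

/-- Tuned parameters for an environment in which the empirical means of the first `Emax` episodes
are accurate up to `η`. -/
structure Regime {H A d : ℕ} {Θ Δ : ℝ} (𝓛 : SeqModel H A d Θ Δ) (E : Env A d) where
  p : Params
  N : ℕ
  Emax : ℕ
  η : ℝ
  tuned : IsTuned H d Θ Δ p N η
  feat_le : ∀ i l, E.feat i l ⬝ᵥ E.feat i l ≤ 1
  accurate : Accurate 𝓛 E p.M Emax η

namespace Regime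

variable {H A d : ℕ} {Θ Δ : ℝ} {𝓛 : SeqModel H A d Θ Δ} {E : Env A d} (R : Regime 𝓛 E)

section Invariants

/-- The datasets of step `j` are aligned and normalized, the trace of the inverse Gram matrix
leaves room for further data points only up to a fixed number, and the regression targets are
accurate during the first `Emax` episodes. -/
structure LevelInvariant (m : Machine A d) (j : ℕ) : Prop where
  map_fst : ∀ a, (m.pairs a j).map Prod.fst = m.feats j
  norm_le : ∀ x ∈ m.feats j, x ⬝ᵥ x ≤ 1
  trace_le : (gram R.p.lam (m.feats j))⁻¹.trace +
    (m.feats j).length * ((R.p.ε ^ 2) ^ 2 / (1 + R.p.ε ^ 2)) ≤ d / R.p.lam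
  accurate : m.episode ≤ R.Emax → ∀ a, ∀ z ∈ m.pairs a j,
    |z.2 - 𝓛.θ a j ⬝ᵥ z.1| ≤ targetError H d Θ R.η

/-- The datasets of the steps from `h` on satisfy the invariant. -/
def Invariant (h : ℕ) (m : Machine A d) : Prop := ∀ j, h ≤ j → j < H → R.LevelInvariant m j

/-- A run from `m` to `m'` of amortized cost at most `c` that changes no datasets of the steps
before `h` and maintains the invariant from step `h` on. -/
structure Advance (h c : ℕ) (m m' : Machine A d) : Prop where
  invariant : R.Invariant h m → R.Invariant h m'
  sameBelow : SameBelow h m m'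
  run : Run H (pointCost H A d R.p.M R.N) c m m'

/-- The vector `x` is normalized, and, if the empirical means are accurate, so is `x` as an
estimate of the mean feature after the actions `l`. -/
structure FeatureEstimate (l : List (Fin A)) (x : Vec d) (m : Machine A d) : Prop where
  norm_le : x ⬝ᵥ x ≤ 1
  accurate : m.episode ≤ R.Emax → ∀ i, |x i - 𝓛.μ l i| ≤ R.η

variable {R} {h h' c c' j : ℕ} {m m' m'' : Machine A d} {l : List (Fin A)} {x : Vec d}

theorem LevelInvariant.of_eq (hm : R.LevelInvariant m j) (hf : m'.feats j = m.feats j)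
    (hp : ∀ a, m'.pairs a j = m.pairs a j) (he : m.episode ≤ m'.episode) :
    R.LevelInvariant m' j where
  map_fst a := by rw [hf, hp, hm.map_fst]
  norm_le := by rw [hf]; exact hm.norm_le
  trace_le := by rw [hf]; exact hm.trace_le
  accurate he' a := by rw [hp]; exact hm.accurate (he.trans he') a

theorem LevelInvariant.length_le (hm : R.LevelInvariant m j) : (m.feats j).length ≤ R.N := by
  have htrace : 0 ≤ (gram R.p.lam (m.feats j))⁻¹.trace :=
    (gram_posDef R.tuned.lam_pos _).inv.posSemidef.trace_nonneg
  exact R.tuned.size _ (by linarith [hm.trace_le])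

theorem Invariant.mono (hm : R.Invariant h m) (hh : h ≤ h') : R.Invariant h' m :=
  fun j hj => hm j (hh.trans hj)

theorem Invariant.dataSize_le (hm : R.Invariant 0 m) : dataSize H m ≤ H * R.N := by
  calc dataSize H m ≤ ∑ _j ∈ Finset.range H, R.N := Finset.sum_le_sum fun j hj =>
        (hm j (Nat.zero_le _) (Finset.mem_range.1 hj)).length_le
    _ = H * R.N := by simp

theorem Advance.trans (h₁ : R.Advance h c m m') (h₂ : R.Advance h c' m' m'') :
    R.Advance h (c + c') m m'' :=
  ⟨h₂.invariant ∘ h₁.invariant, h₁.sameBelow.trans h₂.sameBelow, h₁.run.trans h₂.run⟩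

theorem Advance.mono (ha : R.Advance h c m m') (hh : h' ≤ h) (hc : c ≤ c') :
    R.Advance h' c' m m' where
  invariant hm j hj hjH := by
    rcases le_or_gt h j with hle | hlt
    · exact ha.invariant (hm.mono hh) j hle hjH
    · exact (hm j hj hjH).of_eq (ha.sameBelow j hlt).1 (ha.sameBelow j hlt).2 ha.run.episode_le
  sameBelow j hj := ha.sameBelow j (hj.trans_le hh)
  run := ha.run.mono le_rfl hc

theorem advance_of_pureRun (hr : PureRun c m m') (h : ℕ) : R.Advance h c m m' where
  invariant hm j hj hjH := (hm j hj hjH).of_eq (congrFun hr.feats j)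
    (fun a => congrFun (congrFun hr.pairs a) j) hr.episode_le
  sameBelow := hr.sameBelow h
  run := hr.run

theorem FeatureEstimate.of_episode_le (hx : R.FeatureEstimate l x m)
    (he : m.episode ≤ m'.episode) : R.FeatureEstimate l x m' :=
  ⟨hx.norm_le, fun hm' => hx.accurate (he.trans hm')⟩

theorem FeatureEstimate.abs_q_sub_le (hl : l.length < H) (hx : R.FeatureEstimate l x m)
    (he : m.episode ≤ R.Emax) (a : Fin A) :
    |𝓛.θ a l.length ⬝ᵥ x - 𝓛.q l a| ≤ d * Θ * R.η := by
  rw [𝓛.lin l a hl, ← dotProduct_sub]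
  exact abs_dotProduct_le R.tuned.Θ_nonneg (𝓛.θ_le a _ hl) (hx.accurate he)

theorem abs_ridgeEstimate_sub_q_lt (hl : l.length < H) (hm : R.LevelInvariant m l.length)
    (hx : R.FeatureEstimate l x m) (he : m.episode ≤ R.Emax)
    (hc : Covered R.p.lam R.p.ε (m.feats l.length) x) (a : Fin A) :
    |ridgeEstimate R.p.lam (m.feats l.length) (m.pairs a l.length) ⬝ᵥ x - 𝓛.q l a| < Δ / 2 := by
  have htuned := R.tuned
  have hε := htuned.ε_pos
  have hζ : 0 ≤ targetError H d Θ R.η := by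
    have := htuned.Θ_nonneg; have := htuned.η_pos; unfold targetError; positivity
  have hlength : (m.pairs a l.length).length ≤ R.N := by
    simpa [← hm.map_fst a] using hm.length_le
  have hridge := abs_ridgeEstimate_sub_le htuned.lam_pos (m.pairs a l.length) (𝓛.θ a l.length) x
    hε.le htuned.Θ_nonneg (𝓛.θ_le a _ hl)
    (fun z hz => hm.norm_le _ (hm.map_fst a ▸ List.mem_map_of_mem hz)) (hm.accurate he a)
    (by rw [hm.map_fst a]; exact hc)
  rw [hm.map_fst a] at hridge
  refine lt_of_le_of_lt ?_ htuned.precise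
  refine (abs_sub_le _ (𝓛.θ a l.length ⬝ᵥ x) _).trans
    (add_le_add (hridge.trans ?_) (hx.abs_q_sub_le hl he a))
  gcongr

end Invariants

section Programs

variable {l : List (Fin A)} {m : Machine A d}

theorem wp_featureMean (hl : l.length < H) (m : Machine A d) :
    wp (featureMean E R.p.M l) m fun x m' =>
      R.FeatureEstimate l x m' ∧ PureRun (sampleCost H d R.p.M) m m' := by
  refine (EQDP.wp_featureMean E hl.le R.p.M m).mono ?_
  rintro _ m' ⟨rfl, he, hr⟩
  exact ⟨⟨empiricalFeature_dotProduct_self_le_one R.tuned.M_pos R.feat_le _ l,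
    fun hm' => (R.accurate m.episode (he ▸ hm') l hl).1⟩, hr⟩

theorem wp_rewardMean (hl : l.length < H) (a : Fin A) (m : Machine A d) :
    wp (rewardMean E R.p.M l a) m fun x m' =>
      (m'.episode ≤ R.Emax → |x - 𝓛.r l a| ≤ R.η) ∧ PureRun (sampleCost H d R.p.M) m m' := by
  refine (EQDP.wp_rewardMean E hl.le R.p.M a m).mono ?_
  rintro _ m' ⟨rfl, he, hr⟩
  exact ⟨fun hm' => (R.accurate m.episode (he ▸ hm') l hl).2 a, hr⟩

theorem wp_covered {h : ℕ} (hm : R.LevelInvariant m h) (x : Vec d) :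
    wp (covered R.p h x) m fun b m' => (b = true ↔ Covered R.p.lam R.p.ε (m.feats h) x) ∧
      PureRun (coverCost d R.N) m m' :=
  (EQDP.wp_covered R.tuned.lam_pos h x m).mono fun _ _ ⟨hb, hr⟩ => ⟨hb, hr.mono (by
    have := hm.length_le
    simp only [coverCost, inverseCost]
    gcongr)⟩

theorem wp_greedy [NeZero A] (hl : l.length < H) {x : Vec d}
    (hm : R.LevelInvariant m l.length) (hx : R.FeatureEstimate l x m) :
    wp (greedy R.p l.length x) m fun b m' =>
      (m.episode ≤ R.Emax → Covered R.p.lam R.p.ε (m.feats l.length) x → 𝓛.q l b = 𝓛.v l) ∧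
        PureRun (greedyCost A d R.N) m m' := by
  refine (EQDP.wp_greedy R.tuned.lam_pos x hm.map_fst).mono fun b m' ⟨hb, hr⟩ => ⟨?_, hr.mono ?_⟩
  · exact fun he hc => 𝓛.q_eq_v_of_abs_sub_lt hl (abs_ridgeEstimate_sub_q_lt hl hm hx he hc) hb
  · have := hm.length_le
    simp only [greedyCost, inverseCost]
    gcongr

end Programs

end Regime

section Storage

variable {H A d : ℕ}

namespace Machine

/-- The machine with a further data point in the dataset `𝒟_{a;h}`. -/
def addPair (m : Machine A d) (a : Fin A) (h : ℕ) (x : Vec d) (y : ℝ) : Machine A d :=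
  { m with
    pairs := Function.update m.pairs a
      (Function.update (m.pairs a) h ((x, y) :: m.pairs a h)) }

/-- The machine with a further data point in the dataset `𝒟_h`. -/
def addFeat (m : Machine A d) (h : ℕ) (x : Vec d) : Machine A d :=
  { m with feats := Function.update m.feats h (x :: m.feats h) }

theorem addPair_pairs (m : Machine A d) (a b : Fin A) (h j : ℕ) (x : Vec d) (y : ℝ) :
    (m.addPair a h x y).pairs b j =
      if b = a ∧ j = h then (x, y) :: m.pairs a h else m.pairs b j := by
  by_cases hb : b = a
  · subst hb
    simp [addPair, Function.update_apply]
  · simp [addPair, hb]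

theorem addFeat_feats (m : Machine A d) (h j : ℕ) (x : Vec d) :
    (m.addFeat h x).feats j = if j = h then x :: m.feats h else m.feats j :=
  Function.update_apply _ _ _ _

end Machine

theorem wp_storePair (a : Fin A) (h : ℕ) (x : Vec d) (y : ℝ) (m : Machine A d) :
    wp (storePair a h x y) m fun _ m' => m' = m.addPair a h x y := rfl

theorem wp_storeFeat (h : ℕ) (x : Vec d) (m : Machine A d) :
    wp (storeFeat h x) m fun _ m' => m' = m.addFeat h x := rfl

theorem dataSize_addFeat {h : ℕ} (hh : h < H) (m : Machine A d) (x : Vec d) :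
    dataSize H (m.addFeat h x) = dataSize H m + 1 := by
  have hlength (j : ℕ) : ((m.addFeat h x).feats j).length =
      (m.feats j).length + if j = h then 1 else 0 := by
    rw [Machine.addFeat_feats]
    split_ifs with hj
    · rw [hj, List.length_cons]
    · rfl
  simp only [dataSize, hlength, Finset.sum_add_distrib, Finset.sum_ite_eq', Finset.mem_range, hh,
    if_true]

theorem Run.addFeat {K c h : ℕ} {m m' : Machine A d} (hr : Run H K c m m') (hc : c ≤ K)
    (hh : h < H) (x : Vec d) : Run H K 0 m (m'.addFeat h x) where
  episode_le := hr.episode_le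
  episode_add_steps_le := hr.episode_add_steps_le
  dataSize_le := by rw [dataSize_addFeat hh]; exact hr.dataSize_le.trans (Nat.le_succ _)
  steps_le := by
    rw [dataSize_addFeat hh]
    have : (m'.addFeat h x).steps = m'.steps := rfl
    nlinarith [hr.steps_le]

end Storage

namespace Regime

variable {H A d : ℕ} {Θ Δ : ℝ} {𝓛 : SeqModel H A d Θ Δ} {E : Env A d} {R : Regime 𝓛 E}

section Exploration

variable {k i : ℕ} {l : List (Fin A)} {x : Vec d} {m m' m'' : Machine A d} {y : Fin A → ℝ}

variable (R) in
/-- The program `V` estimates the optimal value after the actions `l`, with `k` steps to go. -/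
def EstimatesValue (k : ℕ) (V : Prog A d ℝ) (l : List (Fin A)) : Prop :=
  ∀ m, R.Invariant l.length m → wp V m fun v m' =>
    R.Advance l.length (nodeCost H A d R.p.M R.N * k) m m' ∧
      (m'.episode ≤ R.Emax → |v - 𝓛.v l| ≤ k * R.η)

theorem wp_rewardMean_add (hl : l.length < H) {a : Fin A} {V : Prog A d ℝ}
    (hV : R.EstimatesValue k V (l ++ [a])) (hm : R.Invariant (l.length + 1) m) :
    wp (do
      let r ← rewardMean E R.p.M l a
      let v ← V
      add r v) m fun y m' =>
        R.Advance (l.length + 1) (actionCost H A d R.p.M R.N k) m m' ∧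
          (m'.episode ≤ R.Emax → |y - 𝓛.q l a| ≤ (k + 1) * R.η) := by
  have hlength : (l ++ [a]).length = l.length + 1 := by simp
  refine wp_bind ((R.wp_rewardMean hl a m).mono fun r m₁ ⟨hr, h₁⟩ => ?_)
  have ha₁ := R.advance_of_pureRun h₁ (l.length + 1)
  refine wp_bind ((hV m₁ (hlength ▸ ha₁.invariant hm)).mono fun v m₂ ⟨ha₂, hv⟩ => ?_)
  rw [hlength] at ha₂
  refine ((computes_add r v).wp m₂).mono ?_
  rintro _ m₃ ⟨rfl, he₃, h₃⟩
  refine ⟨(ha₁.trans ha₂).trans (R.advance_of_pureRun h₃ _), fun he => ?_⟩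
  have he₂ : m₂.episode ≤ R.Emax := he₃ ▸ he
  rw [add_one_mul, add_comm (k * R.η)]
  exact 𝓛.abs_add_sub_q_le hl (hr (ha₂.run.episode_le.trans he₂)) (hv he₂)

variable (R) in
/-- The exploration of `x` after the actions `l`, started at `m`, has reached `m'`: it has stored
the estimates `y a` of the first `i` actions, with `k` steps to go after them. -/
structure Explored (l : List (Fin A)) (x : Vec d) (k : ℕ) (m : Machine A d) (i : ℕ)
    (y : Fin A → ℝ) (m' : Machine A d) : Prop where
  invariant : R.Invariant (l.length + 1) m'
  sameBelow : SameBelow l.length m m'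
  feats_eq : m'.feats l.length = m.feats l.length
  pairs_eq : ∀ a : Fin A, m'.pairs a l.length =
    if a < i then (x, y a) :: m.pairs a l.length else m.pairs a l.length
  run : Run H (pointCost H A d R.p.M R.N) (i * actionCost H A d R.p.M R.N k) m m'
  accurate : m'.episode ≤ R.Emax → ∀ a : Fin A, a < i → |y a - 𝓛.q l a| ≤ (k + 1) * R.η

theorem Explored.zero (hm : R.Invariant l.length m) : R.Explored l x k m 0 y m where
  invariant := hm.mono (Nat.le_succ _)
  sameBelow _ _ := ⟨rfl, fun _ => rfl⟩
  feats_eq := rfl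
  pairs_eq _ := rfl
  run := (PureRun.refl m).run.mono le_rfl (Nat.zero_le _)
  accurate _ _ ha := absurd ha (Nat.not_lt_zero _)

theorem Explored.succ {i : Fin A} {z : ℝ} (h : R.Explored l x k m i y m')
    (ha : R.Advance (l.length + 1) (actionCost H A d R.p.M R.N k) m' m'')
    (hz : m''.episode ≤ R.Emax → |z - 𝓛.q l i| ≤ (k + 1) * R.η) :
    R.Explored l x k m (i + 1) (Function.update y i z) (m''.addPair i l.length x z) where
  invariant j hj hjH := (ha.invariant h.invariant j hj hjH).of_eq rfl
    (fun a => by rw [Machine.addPair_pairs, if_neg (by omega)]) le_rfl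
  sameBelow j hj := by
    have hsame := h.sameBelow.trans (fun j hj => ha.sameBelow j (hj.trans (Nat.lt_succ_self _)))
    exact ⟨(hsame j hj).1, fun a => by
      rw [Machine.addPair_pairs, if_neg (by omega), (hsame j hj).2]⟩
  feats_eq := (ha.sameBelow _ (Nat.lt_succ_self _)).1.trans h.feats_eq
  pairs_eq a := by
    have hpairs (a : Fin A) := ((ha.sameBelow _ (Nat.lt_succ_self _)).2 a).trans (h.pairs_eq a)
    rw [Machine.addPair_pairs]
    rcases eq_or_ne a i with rfl | hne
    · simp [hpairs]
    · have : (a : ℕ) < i + 1 ↔ (a : ℕ) < i := by have := Fin.val_ne_of_ne hne; omega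
      simp [hpairs, hne, this]
  run :=
    have hrun := (h.run.trans ha.run).mono le_rfl (Nat.succ_mul _ _).ge
    ⟨hrun.1, hrun.2, hrun.3, hrun.4⟩
  accurate he a hai := by
    rcases eq_or_ne a i with rfl | hne
    · simpa using hz he
    · rw [Function.update_of_ne hne]
      have := Fin.val_ne_of_ne hne
      exact h.accurate (ha.run.episode_le.trans he) a (by omega)

theorem LevelInvariant.insert {h : ℕ} (hm : R.LevelInvariant m h) (hx : x ⬝ᵥ x ≤ 1)
    (hc : ¬ Covered R.p.lam R.p.ε (m.feats h) x) (hf : m'.feats h = x :: m.feats h)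
    (hp : ∀ a, m'.pairs a h = (x, y a) :: m.pairs a h) (he : m.episode ≤ m'.episode)
    (hy : m'.episode ≤ R.Emax → ∀ a, |y a - 𝓛.θ a h ⬝ᵥ x| ≤ targetError H d Θ R.η) :
    R.LevelInvariant m' h where
  map_fst a := by rw [hf, hp, List.map_cons, hm.map_fst]
  norm_le := by rw [hf]; exact List.forall_mem_cons.2 ⟨hx, hm.norm_le⟩
  trace_le := by
    have htrace := trace_inv_add_vecMulVec_self_le (gram_posDef R.tuned.lam_pos (m.feats h))
      (sq_nonneg R.p.ε) hx (not_le.1 hc).le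
    rw [hf, gram_cons, List.length_cons]
    push_cast
    linarith [hm.trace_le]
  accurate he' a := by
    rw [hp]
    exact List.forall_mem_cons.2 ⟨hy he' a, hm.accurate (he.trans he') a⟩

theorem Explored.addFeat (h : R.Explored l x k m A y m') (hl : l.length + k < H)
    (hm : R.Invariant l.length m) (hx : R.FeatureEstimate l x m)
    (hc : ¬ Covered R.p.lam R.p.ε (m.feats l.length) x) :
    R.Advance l.length 0 m (m'.addFeat l.length x) where
  invariant _ j hj hjH := by
    rcases hj.eq_or_lt with rfl | hlt
    · refine (hm _ le_rfl hjH).insert hx.norm_le hc (by rw [Machine.addFeat_feats, if_pos rfl,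
        h.feats_eq]) (fun a => (h.pairs_eq a).trans (if_pos a.2)) h.run.episode_le fun he a => ?_
      have hθ := hx.abs_q_sub_le hjH (h.run.episode_le.trans he) a
      have hk : ((k : ℝ) + 1) * R.η ≤ H * R.η := by
        have := R.tuned.η_pos
        gcongr
        exact_mod_cast (by omega : k + 1 ≤ H)
      rw [targetError, add_mul]
      refine (abs_sub_le _ (𝓛.q l a) _).trans
        (add_le_add ((h.accurate he a a.2).trans hk) ?_)
      rwa [abs_sub_comm]
    · exact (h.invariant j hlt hjH).of_eq
        (by rw [Machine.addFeat_feats, if_neg (by omega)]) (fun _ => rfl) le_rfl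
  sameBelow j hj := by
    refine ⟨?_, (h.sameBelow j hj).2⟩
    rw [Machine.addFeat_feats, if_neg hj.ne, (h.sameBelow j hj).1]
  run := by
    refine h.run.addFeat ?_ (by omega) x
    simp only [pointCost, actionCost]
    gcongr
    omega

theorem wp_explore {V : List (Fin A) → Prog A d ℝ} (hl : l.length + k < H)
    (hV : ∀ a, R.EstimatesValue k (V (l ++ [a])) (l ++ [a])) (hm : R.Invariant l.length m)
    (hx : R.FeatureEstimate l x m) (hc : ¬ Covered R.p.lam R.p.ε (m.feats l.length) x) :
    wp (explore E R.p V l x) m fun y m' => R.Advance l.length 0 m m' ∧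
      dataSize H m < dataSize H m' ∧
        (m'.episode ≤ R.Emax → ∀ a, |y a - 𝓛.q l a| ≤ (k + 1) * R.η) := by
  have hlH : l.length < H := by omega
  refine wp_bind ((wp_tabulate (R.Explored l x k m) (fun i y m₁ h₁ => ?_) (fun _ => 0)
    (.zero hm)).mono fun y m₁ h₁ => ?_)
  · refine wp_bind (p := do
      let r ← rewardMean E R.p.M l i
      let v ← V (l ++ [i])
      add r v) (f := fun y => do
        storePair i l.length x y
        pure y) ((wp_rewardMean_add hlH (hV i) h₁.invariant).mono fun z m₂ ⟨ha, hz⟩ => ?_)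
    refine wp_bind ((wp_storePair _ _ _ _ m₂).mono ?_)
    rintro - _ rfl
    exact h₁.succ ha hz
  · refine wp_bind ((wp_storeFeat _ _ m₁).mono ?_)
    rintro - _ rfl
    refine wp_pure ⟨h₁.addFeat hl hm hx hc, ?_, fun he a => h₁.accurate he a a.2⟩
    rw [dataSize_addFeat hlH]
    exact Nat.lt_succ_of_le h₁.run.dataSize_le

end Exploration

end Regime

namespace Regime

variable {H A d : ℕ} {Θ Δ : ℝ} {𝓛 : SeqModel H A d Θ Δ} {E : Env A d} {R : Regime 𝓛 E}

section Values

variable [NeZero A] {k : ℕ} {l : List (Fin A)} {x : Vec d} {m : Machine A d}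
  {V : List (Fin A) → Prog A d ℝ}

theorem estimatesValue_computeV_zero (hl : l.length = H) :
    R.EstimatesValue 0 (computeV E R.p 0 l) l := fun m _ =>
  wp_pure ⟨R.advance_of_pureRun (.refl m) _, fun _ => by simp [𝓛.v_end l hl]⟩

theorem estimatesValue_computeV_one (hl : l.length + 1 = H) :
    R.EstimatesValue 1 (computeV E R.p 1 l) l := fun m _ => by
  have hlH : l.length < H := by omega
  refine wp_bind ((wp_tabulate (fun i y m' => PureRun (i * sampleCost H d R.p.M) m m' ∧
    (m'.episode ≤ R.Emax → ∀ a : Fin A, a < i → |y a - 𝓛.q l a| ≤ R.η))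
    (fun i y m₁ ⟨h₁, hy⟩ => ?_) (fun _ => 0)
    ⟨(PureRun.refl m).mono (Nat.zero_le _), fun _ _ ha => absurd ha (Nat.not_lt_zero _)⟩).mono
    fun y m₁ ⟨h₁, hy⟩ => ?_)
  · refine (R.wp_rewardMean hlH i m₁).mono fun r m₂ ⟨hr, h₂⟩ =>
      ⟨(h₁.trans h₂).mono (Nat.succ_mul _ _).ge, fun he a hai => ?_⟩
    rcases eq_or_ne a i with rfl | hne
    · rw [Function.update_self, 𝓛.q_eq l a hlH, 𝓛.v_end _ (by simpa using hl), add_zero]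
      exact hr he
    · rw [Function.update_of_ne hne]
      have := Fin.val_ne_of_ne hne
      exact hy (h₂.episode_le.trans he) a (by omega)
  · refine wp_bind ((wp_argmax y m₁).mono fun b m₂ ⟨hb, h₂⟩ => wp_pure ⟨?_, fun he => ?_⟩)
    · refine (R.advance_of_pureRun (h₁.trans h₂) _).mono le_rfl ?_
      simp only [nodeCost]
      omega
    · simpa using 𝓛.abs_max_sub_v_le hlH (fun a => hy (h₂.episode_le.trans he) a a.2) hb

theorem wp_greedy_rewardMean_add (hl : l.length < H)
    (hV : ∀ a, R.EstimatesValue k (V (l ++ [a])) (l ++ [a])) (hm : R.Invariant l.length m)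
    (hx : R.FeatureEstimate l x m) (hc : Covered R.p.lam R.p.ε (m.feats l.length) x) :
    wp (do
      let a ← greedy R.p l.length x
      let r ← rewardMean E R.p.M l a
      let v ← V (l ++ [a])
      add r v) m fun v m' =>
        R.Advance l.length (greedyCost A d R.N + actionCost H A d R.p.M R.N k) m m' ∧
          (m'.episode ≤ R.Emax → |v - 𝓛.v l| ≤ (k + 1) * R.η) := by
  refine wp_bind ((R.wp_greedy hl (hm _ le_rfl hl) hx).mono fun a m₁ ⟨ha, h₁⟩ => ?_)
  have ha₁ := R.advance_of_pureRun h₁ l.length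
  refine (wp_rewardMean_add hl (hV a) ((ha₁.invariant hm).mono (Nat.le_succ _))).mono
    fun v m₂ ⟨ha₂, hv⟩ => ⟨ha₁.trans (ha₂.mono (Nat.le_succ _) le_rfl), fun he => ?_⟩
  rw [← ha (h₁.episode_le.trans (ha₂.run.episode_le.trans he)) hc]
  exact hv he

theorem wp_explore_argmax (hl : l.length + k < H)
    (hV : ∀ a, R.EstimatesValue k (V (l ++ [a])) (l ++ [a])) (hm : R.Invariant l.length m)
    (hx : R.FeatureEstimate l x m) (hc : ¬ Covered R.p.lam R.p.ε (m.feats l.length) x) :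
    wp (do
      let y ← explore E R.p V l x
      let b ← argmax y
      pure (y b)) m fun v m' => R.Advance l.length A m m' ∧
        (m'.episode ≤ R.Emax → |v - 𝓛.v l| ≤ (k + 1) * R.η) := by
  refine wp_bind ((wp_explore hl hV hm hx hc).mono fun y m₁ ⟨ha₁, _, hy⟩ => ?_)
  refine wp_bind ((wp_argmax y m₁).mono fun b m₂ ⟨hb, h₂⟩ => wp_pure ⟨?_, fun he => ?_⟩)
  · exact (ha₁.trans (R.advance_of_pureRun h₂ _)).mono le_rfl (Nat.zero_add A).le
  · exact 𝓛.abs_max_sub_v_le (by omega) (hy (h₂.episode_le.trans he)) hb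

theorem estimatesValue_computeV_add_two (hl : l.length + (k + 2) = H)
    (hV : ∀ a, R.EstimatesValue (k + 1) (computeV E R.p (k + 1) (l ++ [a])) (l ++ [a])) :
    R.EstimatesValue (k + 2) (computeV E R.p (k + 2) l) l := fun m hm => by
  have hlH : l.length < H := by omega
  refine wp_bind ((R.wp_featureMean hlH m).mono fun x m₁ ⟨hx, h₁⟩ => ?_)
  have hm₁ := (R.advance_of_pureRun h₁ l.length).invariant hm
  refine wp_bind ((R.wp_covered (hm₁ _ le_rfl hlH) x).mono fun b m₂ ⟨hb, h₂⟩ => ?_)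
  have ha₂ := R.advance_of_pureRun (h₁.trans h₂) l.length
  have hx₂ := hx.of_episode_le h₂.episode_le
  have hcost : (k + 1 : ℕ) + (1 : ℝ) = (k + 2 : ℕ) := by push_cast; ring
  rw [← h₂.feats] at hb
  by_cases hbt : b = true
  · rw [if_pos hbt]
    refine (wp_greedy_rewardMean_add hlH hV (ha₂.invariant hm) hx₂ (hb.1 hbt)).mono
      fun v m₃ ⟨ha₃, hv⟩ => ⟨(ha₂.trans ha₃).mono le_rfl ?_, hcost ▸ hv⟩
    rw [Nat.mul_succ (nodeCost H A d R.p.M R.N) (k + 1), actionCost]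
    simp only [nodeCost]
    omega
  · rw [if_neg hbt]
    refine (wp_explore_argmax (by omega) hV (ha₂.invariant hm) hx₂ (mt hb.2 hbt)).mono
      fun v m₃ ⟨ha₃, hv⟩ => ⟨(ha₂.trans ha₃).mono le_rfl ?_, hcost ▸ hv⟩
    rw [Nat.mul_succ (nodeCost H A d R.p.M R.N) (k + 1)]
    simp only [nodeCost]
    omega

theorem estimatesValue_computeV (hl : l.length + k = H) :
    R.EstimatesValue k (computeV E R.p k l) l := by
  induction k using Nat.strong_induction_on generalizing l with
  | _ k ih =>
    match k, ih, hl with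
    | 0, _, hl => exact estimatesValue_computeV_zero hl
    | 1, _, hl => exact estimatesValue_computeV_one hl
    | k + 2, ih, hl =>
      exact estimatesValue_computeV_add_two hl fun a => ih (k + 1) (by omega)
        (by rw [List.length_append, List.length_singleton]; omega)

end Values

section MainLoop

variable (R) in
/-- The actions `as` were chosen one after the other after `l`, at the feature estimates `xs`, by a
rule that is optimal at covered features if the empirical means are accurate; the estimates were
made before `m`. -/
inductive GreedyPath (m : Machine A d) : List (Fin A) → List (Fin A) → List (Vec d) → Prop
  | nil (l) : GreedyPath m l [] []
  | cons {l a as x xs} (length_lt : l.length < H) (feature : R.FeatureEstimate l x m)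
      (optimal : m.episode ≤ R.Emax → Covered R.p.lam R.p.ε (m.feats l.length) x →
        𝓛.q l a = 𝓛.v l)
      (tail : GreedyPath m (l ++ [a]) as xs) : GreedyPath m l (a :: as) (x :: xs)

variable {k : ℕ} {l as : List (Fin A)} {xs : List (Vec d)} {m : Machine A d}

theorem wp_forward [NeZero A] (hl : l.length + k = H) (hm : R.Invariant 0 m) :
    wp (forward E R.p k l) m fun z m' =>
      ∃ as, z.1 = l ++ as ∧ as.length = k ∧ R.GreedyPath m' l as z.2 ∧
        PureRun (k * (sampleCost H d R.p.M + greedyCost A d R.N)) m m' := by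
  induction k generalizing l m with
  | zero =>
    exact wp_pure ⟨[], (List.append_nil l).symm, rfl, .nil l, (PureRun.refl m).mono (Nat.zero_le _)⟩
  | succ k ih =>
    have hlH : l.length < H := by omega
    refine wp_bind ((R.wp_featureMean hlH m).mono fun x m₁ ⟨hx, h₁⟩ => ?_)
    have hm₁ := (R.advance_of_pureRun h₁ 0).invariant hm
    refine wp_bind ((R.wp_greedy hlH (hm₁ _ (Nat.zero_le _) hlH) hx).mono fun a m₂ ⟨ha, h₂⟩ => ?_)
    refine wp_bind ((ih (l := l ++ [a]) (by rw [List.length_append, List.length_singleton]; omega)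
      ((R.advance_of_pureRun h₂ 0).invariant hm₁)).mono ?_)
    rintro ⟨_, xs⟩ m₃ ⟨as, rfl, hlength, hpath, h₃⟩
    have h₂₃ := h₂.trans h₃
    refine wp_pure ⟨a :: as, by simp, by simp [hlength], ?_,
      (h₁.trans h₂₃).mono (le_of_eq (by ring))⟩
    refine .cons hlH (hx.of_episode_le h₂₃.episode_le) (fun he hc => ?_) hpath
    exact ha (h₂₃.episode_le.trans he) (h₂₃.feats ▸ hc)

/-- A search for an uncovered feature along a greedy path found `u`: nothing, if all features are
covered, in which case the actions are optimal, or the first uncovered one. -/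
def SearchResult (R : Regime 𝓛 E) (m : Machine A d) (l as : List (Fin A)) :
    Option (ℕ × Vec d) → Prop
  | none => m.episode ≤ R.Emax → 𝓛.OptFrom l as
  | some (h, x) => ∃ l₁ l₂, l ++ as = l₁ ++ l₂ ∧ l₁.length = h ∧ h < H ∧
      R.FeatureEstimate l₁ x m ∧ ¬ Covered R.p.lam R.p.ε (m.feats h) x

theorem SearchResult.cons {a : Fin A} {u : Option (ℕ × Vec d)}
    (h : R.SearchResult m (l ++ [a]) as u) (ha : m.episode ≤ R.Emax → 𝓛.q l a = 𝓛.v l) :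
    R.SearchResult m l (a :: as) u := by
  match u, h with
  | none, h => exact fun he => ⟨ha he, h he⟩
  | some (j, x), ⟨l₁, l₂, hl, h⟩ => exact ⟨l₁, l₂, by rw [← hl, List.append_cons], h⟩

theorem GreedyPath.wp_firstUncovered {m₀ : Machine A d} (hpath : R.GreedyPath m₀ l as xs)
    (hm : R.Invariant 0 m) (hfeats : m.feats = m₀.feats) :
    wp (firstUncovered R.p l.length xs) m fun u m' => R.SearchResult m₀ l as u ∧
      PureRun (as.length * coverCost d R.N) m m' := by
  induction hpath generalizing m with
  | nil l => exact wp_pure ⟨fun _ => trivial, (PureRun.refl m).mono (Nat.zero_le _)⟩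
  | @cons l a as x xs hlH hx ha _ ih =>
    refine wp_bind ((R.wp_covered (hm _ (Nat.zero_le _) hlH) x).mono fun b m₁ ⟨hb, h₁⟩ => ?_)
    rw [hfeats] at hb
    by_cases hbt : b = true
    · have htail := ih ((R.advance_of_pureRun h₁ 0).invariant hm) (h₁.feats.trans hfeats)
      rw [List.length_append, List.length_singleton] at htail
      rw [if_pos hbt]
      exact htail.mono fun u m₂ ⟨hu, h₂⟩ => ⟨hu.cons fun he => ha he (hb.1 hbt),
        (h₁.trans h₂).mono (by rw [List.length_cons, Nat.succ_mul, Nat.add_comm])⟩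
    · rw [if_neg hbt]
      exact wp_pure ⟨⟨l, a :: as, rfl, rfl, hlH, hx, mt hb.2 hbt⟩,
        h₁.mono (by rw [List.length_cons, Nat.succ_mul]; omega)⟩

variable (R) in
/-- The result of a round of the main loop: either no output and a new data point, or an output,
which is optimal if the empirical means are accurate. -/
def RoundResult (m m' : Machine A d) : Option (List (Fin A)) → Prop
  | none => dataSize H m < dataSize H m'
  | some l => l.length = H ∧ (m'.episode ≤ R.Emax → 𝓛.OptFrom [] l)

theorem wp_round [NeZero A] (hm : R.Invariant 0 m) :
    wp (round E R.p H) m fun u m' =>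
      R.Advance 0 (roundCost H A d R.p.M R.N) m m' ∧ R.RoundResult m m' u := by
  refine wp_bind ((wp_forward (l := []) (by simp) hm).mono ?_)
  rintro ⟨as, xs⟩ m₁ ⟨_, rfl, hlength, hpath, h₁⟩
  have hm₁ := (R.advance_of_pureRun h₁ 0).invariant hm
  refine wp_bind ((hpath.wp_firstUncovered hm₁ rfl).mono fun u m₂ ⟨hu, h₂⟩ => ?_)
  rw [hlength] at h₂
  have ha₂ : R.Advance 0 (roundCost H A d R.p.M R.N) m m₂ := R.advance_of_pureRun (h₁.trans h₂) 0
  rcases u with _ | ⟨h, x⟩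
  · exact wp_pure ⟨ha₂, hlength, fun he => hu (h₂.episode_le.trans he)⟩
  · obtain ⟨l₁, l₂, hl, rfl, hh, hx, hc⟩ := hu
    refine wp_bind (p := explore E R.p (computeV E R.p (H - (l₁.length + 1)))
      (as.take l₁.length) x) ?_
    rw [← List.nil_append as, hl, List.take_left]
    refine (wp_explore (by omega)
      (fun a => estimatesValue_computeV (l := l₁ ++ [a])
        (by rw [List.length_append, List.length_singleton]; omega))
      ((ha₂.invariant hm).mono (Nat.zero_le _)) (hx.of_episode_le h₂.episode_le)
      (h₂.feats ▸ hc)).mono fun _ m₃ ⟨ha₃, hsize, _⟩ => ?_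
    exact wp_pure ⟨ha₂.trans (ha₃.mono (Nat.zero_le _) le_rfl),
      ha₂.run.dataSize_le.trans_lt hsize⟩

theorem wp_rounds [NeZero A] {n : ℕ} (hm : R.Invariant 0 m) (hn : H * R.N < n + dataSize H m) :
    wp (rounds E R.p H n) m fun u m' => ∃ l, u = some l ∧ l.length = H ∧
      (m'.episode ≤ R.Emax → 𝓛.OptFrom [] l) ∧ R.Invariant 0 m' ∧
        Run H (pointCost H A d R.p.M R.N + roundCost H A d R.p.M R.N)
          (roundCost H A d R.p.M R.N) m m' := by
  induction n generalizing m with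
  | zero => have := hm.dataSize_le; omega
  | succ n ih =>
    refine wp_bind ((wp_round hm).mono fun u m₁ ⟨ha, hu⟩ => ?_)
    have hm₁ := ha.invariant hm
    match u, hu with
    | none, hsize =>
      have : dataSize H m < dataSize H m₁ := hsize
      refine (ih hm₁ (by omega)).mono ?_
      rintro u m₂ ⟨l, rfl, hl, hopt, hm₂, hrun⟩
      exact ⟨l, rfl, hl, hopt, hm₂,
        ((ha.run.amortize hsize).trans hrun).mono le_rfl (Nat.zero_add _).le⟩
    | some l, ⟨hl, hopt⟩ =>
      exact wp_pure ⟨l, rfl, hl, hopt, hm₁, ha.run.mono (Nat.le_add_right _ _) le_rfl⟩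

variable (R) in
theorem invariant_start : R.Invariant 0 (Machine.start A d) := fun _ _ _ =>
  { map_fst := fun _ => rfl
    norm_le := by simp [Machine.start]
    trace_le := by simp [Machine.start, trace_inv_gram_nil]
    accurate := by simp [Machine.start] }

variable (R) in
theorem terminates [NeZero A] : ∃ l c, Terminates E R.p H l c ∧ c ≤ totalCost H A d R.p.M R.N ∧
    (totalCost H A d R.p.M R.N ≤ R.Emax → l.length = H ∧ 𝓛.OptFrom [] l) := by
  obtain ⟨l, houtput, hl, hopt, hm, hrun⟩ := wp_rounds (n := H * R.N + 1) R.invariant_start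
    (by omega)
  have hsteps := hrun.steps_le
  have hsize := Nat.mul_le_mul_left
    (pointCost H A d R.p.M R.N + roundCost H A d R.p.M R.N) hm.dataSize_le
  have hepisode := hrun.episode_add_steps_le
  have hstart : (Machine.start A d).steps = 0 ∧ (Machine.start A d).episode = 0 := ⟨rfl, rfl⟩
  have hcost : ((rounds E R.p H (H * R.N + 1)).run (Machine.start A d)).2.steps ≤
      totalCost H A d R.p.M R.N := by
    simp only [totalCost]
    omega
  exact ⟨l, _, ⟨_, houtput, rfl⟩, hcost, fun hE => ⟨hl, hopt (by omega)⟩⟩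

end MainLoop

end Regime

section Preliminaries

theorem integral_le_integral_of_le {X : Type*} [MeasurableSpace X] {μ : Measure X} {f g : X → ℝ}
    (hfg : ∀ x, f x ≤ g x) (hg : Integrable g μ) (hg₀ : 0 ≤ ∫ x, g x ∂μ) :
    ∫ x, f x ∂μ ≤ ∫ x, g x ∂μ := by
  by_cases hf : Integrable f μ
  · exact integral_mono hf hg hfg
  · rwa [integral_undef hf]

theorem sum_toReal_pmf {α : Type*} [Fintype α] (p : PMF α) : ∑ a, (p a).toReal = 1 := by
  rw [← ENNReal.toReal_sum fun a _ => p.apply_ne_top a, ← tsum_fintype (L := .unconditional _),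
    p.tsum_coe, ENNReal.toReal_one]

theorem inner_eq_dotProduct {d : ℕ} (x y : EuclideanSpace ℝ (Fin d)) :
    inner ℝ x y = x.ofLp ⬝ᵥ y.ofLp := by
  rw [EuclideanSpace.inner_eq_star_dotProduct, dotProduct_comm, star_trivial]

end Preliminaries

namespace DetPOMDP

variable {S : Type*} {O : Type*} [MeasurableSpace O] {A : ℕ} (𝓜 : DetPOMDP S O A)

section Values

theorem latentFrom_append (h : ℕ) (s : S) (l : List (Fin A)) (a : Fin A) :
    𝓜.latentFrom h s (l ++ [a]) = 𝓜.next (h + l.length) (𝓜.latentFrom h s l) a := by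
  induction l generalizing h s with
  | nil => rfl
  | cons b l ih =>
    rw [List.cons_append, latentFrom, ih, List.length_cons, Nat.add_right_comm, Nat.add_assoc]
    rfl

theorem latent_append (l : List (Fin A)) (a : Fin A) :
    𝓜.latent (l ++ [a]) = 𝓜.next l.length (𝓜.latent l) a := by
  rw [latent, latentFrom_append, Nat.zero_add]
  rfl

theorem integrable_reward (h : ℕ) (s : S) (a : Fin A) :
    Integrable (fun x : ℝ => x) (𝓜.reward h s a) :=
  .of_mem_Icc 0 1 measurable_id.aemeasurable (𝓜.reward_mem h s a)

theorem integral_reward_add (h : ℕ) (s : S) (a : Fin A) (c : ℝ) :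
    ∫ x, (x + c) ∂(𝓜.reward h s a) = 𝓜.meanReward h s a + c := by
  simp [integral_add (𝓜.integrable_reward h s a) (integrable_const c), meanReward]

theorem meanReward_nonneg (h : ℕ) (s : S) (a : Fin A) : 0 ≤ 𝓜.meanReward h s a :=
  integral_nonneg_of_ae ((𝓜.reward_mem h s a).mono fun _ hx => hx.1)

variable [NeZero A]

theorem Qstar_eq_of_add_eq {H h k : ℕ} (hk : h + (k + 1) = H) (s : S) (a : Fin A) :
    𝓜.Qstar H h s a = 𝓜.meanReward h s a + 𝓜.optValue k (h + 1) (𝓜.next h s a) := by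
  rw [Qstar, Vstar, show H - (h + 1) = k by omega]

theorem Vstar_eq_sup {H h : ℕ} (hh : h < H) (s : S) :
    𝓜.Vstar H h s = Finset.univ.sup' Finset.univ_nonempty fun a => 𝓜.Qstar H h s a := by
  obtain ⟨k, rfl⟩ : ∃ k, H = h + (k + 1) := ⟨H - h - 1, by omega⟩
  simp only [𝓜.Qstar_eq_of_add_eq rfl]
  rw [Vstar, Nat.add_sub_cancel_left]
  rfl

theorem optValue_nonneg (k h : ℕ) (s : S) : 0 ≤ 𝓜.optValue k h s := by
  induction k generalizing h s with
  | zero => exact le_rfl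
  | succ k ih =>
    refine le_trans ?_ (Finset.le_sup' _ (Finset.mem_univ (0 : Fin A)))
    exact add_nonneg (𝓜.meanReward_nonneg _ _ _) (ih _ _)

theorem meanReward_add_optValue_le (k h : ℕ) (s : S) (a : Fin A) :
    𝓜.meanReward h s a + 𝓜.optValue k (h + 1) (𝓜.next h s a) ≤ 𝓜.optValue (k + 1) h s :=
  Finset.le_sup' (fun a => 𝓜.meanReward h s a + 𝓜.optValue k (h + 1) (𝓜.next h s a))
    (Finset.mem_univ a)

theorem valueFrom_le_optValue (π : Policy O A) (k h : ℕ) (s : S)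
    (hist : List (O × Fin A × ℝ)) : 𝓜.valueFrom π k h s hist ≤ 𝓜.optValue k h s := by
  induction k generalizing h s hist with
  | zero => exact le_rfl
  | succ k ih =>
    have haction (o : O) (a : Fin A) :
        ∫ x, (x + 𝓜.valueFrom π k (h + 1) (𝓜.next h s a) (hist ++ [(o, a, x)]))
          ∂(𝓜.reward h s a) ≤ 𝓜.optValue (k + 1) h s := by
      refine (integral_le_integral_of_le (fun x => add_le_add_right (ih _ _ _) x)
        ((𝓜.integrable_reward h s a).add (integrable_const _)) ?_).trans ?_
      all_goals rw [𝓜.integral_reward_add]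
      · exact add_nonneg (𝓜.meanReward_nonneg _ _ _) (𝓜.optValue_nonneg _ _ _)
      · exact 𝓜.meanReward_add_optValue_le k h s a
    have hobservation (o : O) : ∑ a : Fin A, (π hist o a).toReal *
        ∫ x, (x + 𝓜.valueFrom π k (h + 1) (𝓜.next h s a) (hist ++ [(o, a, x)]))
          ∂(𝓜.reward h s a) ≤ 𝓜.optValue (k + 1) h s := by
      refine (Finset.sum_le_sum fun a _ =>
        mul_le_mul_of_nonneg_left (haction o a) ENNReal.toReal_nonneg).trans_eq ?_
      rw [← Finset.sum_mul, sum_toReal_pmf, one_mul]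
    have hconst : ∫ _, 𝓜.optValue (k + 1) h s ∂(𝓜.emission h s) = 𝓜.optValue (k + 1) h s := by
      simp
    calc 𝓜.valueFrom π (k + 1) h s hist
        ≤ ∫ _, 𝓜.optValue (k + 1) h s ∂(𝓜.emission h s) :=
          integral_le_integral_of_le hobservation (integrable_const _)
            (hconst.symm ▸ 𝓜.optValue_nonneg _ _ _)
      _ = 𝓜.optValue (k + 1) h s := hconst

theorem valueFrom_openLoop_of_getD_eq {L : List (Fin A)} {k h : ℕ} {s : S} {v : ℝ}
    {hist : List (O × Fin A × ℝ)} {a : Fin A} (ha : L.getD hist.length 0 = a)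
    (hv : ∀ o x, 𝓜.valueFrom (openLoop L) k (h + 1) (𝓜.next h s a) (hist ++ [(o, a, x)]) = v) :
    𝓜.valueFrom (openLoop L) (k + 1) h s hist = 𝓜.meanReward h s a + v := by
  have hpure (o : O) : openLoop L hist o = PMF.pure a := by rw [openLoop, ha]
  have hobservation (o : O) : ∑ b : Fin A, (openLoop L hist o b).toReal *
      ∫ x, (x + 𝓜.valueFrom (openLoop L) k (h + 1) (𝓜.next h s b) (hist ++ [(o, b, x)]))
        ∂(𝓜.reward h s b) = 𝓜.meanReward h s a + v := by
    rw [Finset.sum_eq_single a (fun b _ hb => by simp [hpure, PMF.pure_apply, hb]) (by simp)]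
    simp only [hpure, PMF.pure_apply_self, ENNReal.toReal_one, one_mul, hv, integral_reward_add]
  simp only [valueFrom, hobservation]
  simp

end Values

section SeqModel

variable {H h d dₛ : ℕ} {Θ Δ W : ℝ}

/-- A vector of norm at most `Θ` that represents the optimal value of the action `a` at step `h`
as a linear function of the mean observation feature. -/
def IsObservationWeight [NeZero A] (H h : ℕ) (a : Fin A) (ψ : O → EuclideanSpace ℝ (Fin d))
    (Θ : ℝ) (θ : EuclideanSpace ℝ (Fin d)) : Prop :=
  ‖θ‖ ≤ Θ ∧ ∀ s, 𝓜.Qstar H h s a = inner ℝ θ (∫ o, ψ o ∂(𝓜.emission h s))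

variable {𝓜} {ψ : O → EuclideanSpace ℝ (Fin d)} {φ : S → EuclideanSpace ℝ (Fin dₛ)}
  {G : Fin H → Matrix (Fin d) (Fin dₛ) ℝ}

theorem IsMeanEmbedding.iInf_minSingularValue_pos (hG : 𝓜.IsMeanEmbedding H ψ φ G)
    (hdₛ : 0 < dₛ) (hH : 0 < H) : 0 < ⨅ h, minSingularValue (G h) := by
  have : Nonempty (Fin H) := ⟨⟨0, hH⟩⟩
  obtain ⟨h, hh⟩ := exists_eq_ciInf_of_finite (f := fun h => minSingularValue (G h))
  obtain ⟨L, hL⟩ := (hG h).2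
  exact hh ▸ minSingularValue_pos hdₛ hL

theorem IsMeanEmbedding.exists_isObservationWeight [NeZero A] (hG : 𝓜.IsMeanEmbedding H ψ φ G)
    (hdₛ : 0 < dₛ) (hQ : 𝓜.LinearQstar H φ W) (a : Fin A) (hh : h < H) :
    ∃ θ, 𝓜.IsObservationWeight H h a ψ (W / ⨅ h, minSingularValue (G h)) θ := by
  obtain ⟨w, hw, hwQ⟩ := hQ h hh a
  have hpos := hG.iInf_minSingularValue_pos hdₛ (Nat.zero_lt_of_lt hh)
  have hle (v) : (⨅ h, minSingularValue (G h)) * ‖v‖ ≤ ‖Matrix.toEuclideanLin (G ⟨h, hh⟩) v‖ :=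
    (mul_le_mul_of_nonneg_right (ciInf_le (Set.finite_range _).bddBelow _) (norm_nonneg v)).trans
      (minSingularValue_mul_norm_le _ v)
  obtain ⟨θ, hθ, hinner⟩ := exists_inner_map_eq_inner hpos hle w
  refine ⟨θ, hθ.trans (by gcongr), fun s => ?_⟩
  rw [hwQ, ← hinner, ← (hG ⟨h, hh⟩).1 s]

theorem LinearQstar.nonneg [NeZero A] (hQ : 𝓜.LinearQstar H φ W) (hH : 0 < H) : 0 ≤ W := by
  obtain ⟨w, hw, -⟩ := hQ 0 hH 0
  exact (norm_nonneg w).trans hw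

/-- The model `𝓜` as seen along sequences of actions. -/
noncomputable def seqModel [NeZero A] {θ : Fin A → ℕ → EuclideanSpace ℝ (Fin d)}
    (hθ : ∀ a, ∀ h < H, 𝓜.IsObservationWeight H h a ψ Θ (θ a h)) (hgap : 𝓜.HasGap H Δ) :
    SeqModel H A d Θ Δ where
  r l a := 𝓜.meanReward l.length (𝓜.latent l) a
  q l a := 𝓜.Qstar H l.length (𝓜.latent l) a
  v l := 𝓜.Vstar H l.length (𝓜.latent l)
  μ l := (∫ o, ψ o ∂(𝓜.emission l.length (𝓜.latent l))).ofLp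
  θ a h := (θ a h).ofLp
  q_eq l a _ := by rw [latent_append, List.length_append, List.length_singleton, Qstar]
  v_end l hl := by rw [hl, Vstar, Nat.sub_self, optValue]
  q_le l a hl := by
    rw [Vstar_eq_sup _ hl]
    exact Finset.le_sup' (fun a => 𝓜.Qstar H l.length (𝓜.latent l) a) (Finset.mem_univ a)
  exists_q_eq l hl := by
    rw [Vstar_eq_sup _ hl]
    obtain ⟨a, -, ha⟩ := Finset.exists_mem_eq_sup' Finset.univ_nonempty
      fun a => 𝓜.Qstar H l.length (𝓜.latent l) a
    exact ⟨a, ha.symm⟩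
  gap l a hl := hgap l.length hl (𝓜.latent l) a
  lin l a hl := by rw [← inner_eq_dotProduct]; exact (hθ a _ hl).2 _
  θ_le a h hh := by
    rw [← inner_eq_dotProduct, real_inner_self_eq_norm_sq]
    exact pow_le_pow_left₀ (norm_nonneg _) (hθ a h hh).1 2

variable [NeZero A] {θ : Fin A → ℕ → EuclideanSpace ℝ (Fin d)}
  {hθ : ∀ a, ∀ h < H, 𝓜.IsObservationWeight H h a ψ Θ (θ a h)} {hgap : 𝓜.HasGap H Δ}

theorem valueFrom_openLoop {l as : List (Fin A)} (hl : l.length + as.length = H)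
    (hopt : (seqModel hθ hgap).OptFrom l as) {hist : List (O × Fin A × ℝ)}
    (hhist : hist.length = l.length) :
    𝓜.valueFrom (openLoop (l ++ as)) as.length l.length (𝓜.latent l) hist =
      𝓜.Vstar H l.length (𝓜.latent l) := by
  induction as generalizing l hist with
  | nil => exact ((seqModel hθ hgap).v_end l hl).symm
  | cons a as ih =>
    rw [List.length_cons] at hl ⊢
    have htail := fun hist => ih (l := l ++ [a]) (hist := hist)
      (by rw [List.length_append, List.length_singleton, ← hl]; omega) hopt.2
    simp only [List.append_assoc, List.singleton_append, latent_append, List.length_append,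
      List.length_singleton] at htail
    rw [𝓜.valueFrom_openLoop_of_getD_eq (by simp [hhist]) fun o x => htail _ (by simp [hhist])]
    exact hopt.1

theorem isOptimalSeq_of_optFrom {l : List (Fin A)} (hl : l.length = H)
    (hopt : (seqModel hθ hgap).OptFrom [] l) : 𝓜.IsOptimalSeq H l := by
  have hvalue := valueFrom_openLoop (by rw [List.length_nil, hl, Nat.zero_add]) hopt (hist := [])
    rfl
  rw [hl] at hvalue
  refine ⟨hl, fun π => ?_⟩
  calc 𝓜.value H π ≤ 𝓜.Vstar H 0 𝓜.init := 𝓜.valueFrom_le_optValue π H 0 𝓜.init []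
    _ = 𝓜.value H (openLoop l) := hvalue.symm

end SeqModel

end DetPOMDP

section Concentration

open ProbabilityTheory

variable {ι : Type*} {Ω : ι → Type*} [∀ i, MeasurableSpace (Ω i)] (P : ∀ i, Measure (Ω i))
  [∀ i, IsProbabilityMeasure (P i)] {X : ∀ i, Ω i → ℝ} {f : ℕ → ι} {a b μ η : ℝ} {M : ℕ}

theorem infinitePi_real_le_mean_sub_le (hX : ∀ i, Measurable (X i)) (hf : f.Injective)
    (hb : ∀ j, ∀ᵐ x ∂P (f j), X (f j) x ∈ Set.Icc a b) (hμ : ∀ j, ∫ x, X (f j) x ∂P (f j) = μ)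
    (hM : 0 < M) (hη : 0 ≤ η) :
    (Measure.infinitePi P).real {ω | η ≤ (∑ j ∈ Finset.range M, X (f j) (ω (f j))) / M - μ} ≤
      Real.exp (-(2 * M * η ^ 2 / (b - a) ^ 2)) := by
  have hM' : (0 : ℝ) < M := by exact_mod_cast hM
  have hindep : iIndepFun (fun j ω => X (f j) (ω (f j)) - μ) (Measure.infinitePi P) :=
    ((iIndepFun_infinitePi (P := P) hX).precomp hf).comp (fun _ x => x - μ) fun _ => by fun_prop
  have hmean (j : ℕ) : ∫ ω, X (f j) (ω (f j)) ∂(Measure.infinitePi P) = μ := by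
    have hmp := measurePreserving_eval_infinitePi P (f j)
    rw [← hμ j, ← hmp.map_eq, integral_map hmp.measurable.aemeasurable
      (hX (f j)).aestronglyMeasurable]
  have hsub (j : ℕ) : HasSubgaussianMGF (fun ω => X (f j) (ω (f j)) - μ) ((‖b - a‖₊ / 2) ^ 2)
      (Measure.infinitePi P) := by
    have hmp := measurePreserving_eval_infinitePi P (f j)
    have h := hasSubgaussianMGF_of_mem_Icc ((hX (f j)).comp hmp.measurable).aemeasurable
      (hmp.quasiMeasurePreserving.ae (hb j))
    simp only [Function.comp_apply] at h
    rwa [hmean] at h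
  have hsum := HasSubgaussianMGF.measure_sum_range_ge_le_of_iIndepFun (n := M) (ε := M * η) hindep
    (fun j _ => hsub j) (by positivity)
  have hset (ω : ∀ i, Ω i) : η ≤ (∑ j ∈ Finset.range M, X (f j) (ω (f j))) / M - μ ↔
      M * η ≤ ∑ j ∈ Finset.range M, (X (f j) (ω (f j)) - μ) := by
    rw [Finset.sum_sub_distrib, Finset.sum_const, Finset.card_range, nsmul_eq_mul,
      le_sub_iff_add_le, le_div_iff₀ hM', le_sub_iff_add_le, add_mul, mul_comm η, mul_comm μ]
  simp only [hset]
  refine hsum.trans_eq (congrArg Real.exp ?_)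
  push_cast
  rw [div_pow, Real.norm_eq_abs, sq_abs]
  field_simp

theorem infinitePi_real_lt_abs_mean_sub_le (hX : ∀ i, Measurable (X i)) (hf : f.Injective)
    (hb : ∀ j, ∀ᵐ x ∂P (f j), X (f j) x ∈ Set.Icc a b) (hμ : ∀ j, ∫ x, X (f j) x ∂P (f j) = μ)
    (hM : 0 < M) (hη : 0 ≤ η) :
    (Measure.infinitePi P).real {ω | η < |(∑ j ∈ Finset.range M, X (f j) (ω (f j))) / M - μ|} ≤
      2 * Real.exp (-(2 * M * η ^ 2 / (b - a) ^ 2)) := by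
  have hupper := infinitePi_real_le_mean_sub_le P hX hf hb hμ hM hη
  have hlower := infinitePi_real_le_mean_sub_le P (X := fun i x => -X i x) (fun i => (hX i).neg) hf
    (fun j => (hb j).mono fun x hx => ⟨neg_le_neg hx.2, neg_le_neg hx.1⟩)
    (fun j => by rw [integral_neg, hμ]) hM hη
  rw [show -a - -b = b - a by ring] at hlower
  rw [two_mul]
  refine (measureReal_mono (fun ω hω => ?_)).trans ((measureReal_union_le _ _).trans
    (add_le_add hupper hlower))
  simp only [Set.mem_union, Set.mem_ofPred_eq, Finset.sum_neg_distrib, neg_div] at hω ⊢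
  exact (lt_abs.1 hω).imp le_of_lt fun h => by linarith

end Concentration

theorem exists_eq_take_ofFn {α : Type*} [Nonempty α] {H : ℕ} {l : List α} (hl : l.length ≤ H) :
    ∃ g : Fin H → α, l = (List.ofFn g).take l.length := by
  obtain ⟨a⟩ := ‹Nonempty α›
  refine ⟨fun i => l.getD i a, List.ext_getElem (by simpa using hl) fun n h₁ h₂ => ?_⟩
  simp [h₁]

namespace DetPOMDP

variable {S : Type*} {O : Type*} [MeasurableSpace O] {A : ℕ} {𝓜 : DetPOMDP S O A} {d M : ℕ}
  {ψ : O → EuclideanSpace ℝ (Fin d)} {η : ℝ}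

theorem env_feat_dotProduct_self_le_one (hψ : ∀ o, ‖ψ o‖ ≤ 1) (ω : Tape S O A) (i : ℕ)
    (l : List (Fin A)) : (𝓜.env ψ ω).feat i l ⬝ᵥ (𝓜.env ψ ω).feat i l ≤ 1 := by
  rw [env, ← inner_eq_dotProduct, real_inner_self_eq_norm_sq]
  exact pow_le_one₀ (norm_nonneg _) (hψ _)

instance : IsProbabilityMeasure 𝓜.tapeLaw := by
  unfold tapeLaw
  infer_instance

theorem tapeLaw_real_fst_mem (s : Set (ℕ × ℕ × S → O)) : 𝓜.tapeLaw.real {ω | ω.1 ∈ s} =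
    (Measure.infinitePi fun i : ℕ × ℕ × S => 𝓜.emission i.2.1 i.2.2).real s := by
  change 𝓜.tapeLaw.real (Prod.fst ⁻¹' s) = _
  rw [← Set.prod_univ, tapeLaw, measureReal_prod_prod, probReal_univ, mul_one]

theorem tapeLaw_real_snd_mem (s : Set (ℕ × ℕ × S × Fin A → ℝ)) :
    𝓜.tapeLaw.real {ω | ω.2 ∈ s} = (Measure.infinitePi fun i : ℕ × ℕ × S × Fin A =>
      𝓜.reward i.2.1 i.2.2.1 i.2.2.2).real s := by
  change 𝓜.tapeLaw.real (Prod.snd ⁻¹' s) = _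
  rw [← Set.univ_prod, tapeLaw, measureReal_prod_prod, probReal_univ, one_mul]

theorem tapeLaw_real_lt_abs_empiricalFeature_sub_le (hψ : Measurable ψ) (hψ₁ : ∀ o, ‖ψ o‖ ≤ 1)
    (hM : 0 < M) (hη : 0 ≤ η) (e : ℕ) (l : List (Fin A)) (i : Fin d) :
    𝓜.tapeLaw.real {ω | η < |empiricalFeature (𝓜.env ψ ω) M e l i -
      (∫ o, ψ o ∂(𝓜.emission l.length (𝓜.latent l))).ofLp i|} ≤
      2 * Real.exp (-(M * (η ^ 2 / 2))) := by
  have hmean : ∫ o, (ψ o).ofLp i ∂(𝓜.emission l.length (𝓜.latent l)) =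
      (∫ o, ψ o ∂(𝓜.emission l.length (𝓜.latent l))).ofLp i :=
    (EuclideanSpace.proj i : EuclideanSpace ℝ (Fin d) →L[ℝ] ℝ).integral_comp_comm
      (.of_bound hψ.aestronglyMeasurable 1 (.of_forall hψ₁))
  have hdev := infinitePi_real_lt_abs_mean_sub_le
    (fun i : ℕ × ℕ × S => 𝓜.emission i.2.1 i.2.2) (X := fun _ o => (ψ o).ofLp i)
    (f := fun j => (e + 1 + j, l.length, 𝓜.latent l)) (fun _ => by fun_prop)
    (fun j j' hj => by simpa using hj)
    (fun _ => .of_forall fun o => abs_le.1 ((PiLp.norm_apply_le (ψ o) i).trans (hψ₁ o)))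
    (fun _ => hmean) hM hη
  rw [show -(2 * M * η ^ 2 / ((1 : ℝ) - -1) ^ 2) = -(M * (η ^ 2 / 2)) by ring] at hdev
  exact (tapeLaw_real_fst_mem _).trans_le hdev

theorem tapeLaw_real_lt_abs_empiricalReward_sub_le (hM : 0 < M) (hη : 0 ≤ η) (e : ℕ)
    (l : List (Fin A)) (a : Fin A) :
    𝓜.tapeLaw.real {ω | η < |empiricalReward (𝓜.env ψ ω) M e l a -
      𝓜.meanReward l.length (𝓜.latent l) a|} ≤ 2 * Real.exp (-(M * (η ^ 2 / 2))) := by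
  have hdev := infinitePi_real_lt_abs_mean_sub_le
    (fun i : ℕ × ℕ × S × Fin A => 𝓜.reward i.2.1 i.2.2.1 i.2.2.2) (X := fun _ x => x)
    (f := fun j => (e + 1 + j, l.length, 𝓜.latent l, a)) (fun _ => measurable_id)
    (fun j j' hj => by simpa using hj)
    (fun _ => (𝓜.reward_mem l.length (𝓜.latent l) a).mono fun x hx =>
      Set.Icc_subset_Icc_left (neg_nonpos.2 zero_le_one) hx)
    (μ := 𝓜.meanReward l.length (𝓜.latent l) a) (fun _ => rfl) hM hη
  rw [show -(2 * M * η ^ 2 / ((1 : ℝ) - -1) ^ 2) = -(M * (η ^ 2 / 2)) by ring] at hdev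
  exact (tapeLaw_real_snd_mem _).trans_le hdev

variable [NeZero A] {H : ℕ} {Θ Δ : ℝ} {θ : Fin A → ℕ → EuclideanSpace ℝ (Fin d)}
  {hθ : ∀ a, ∀ h < H, 𝓜.IsObservationWeight H h a ψ Θ (θ a h)} {hgap : 𝓜.HasGap H Δ}

theorem tapeLaw_real_not_accurate_le (hψ : Measurable ψ) (hψ₁ : ∀ o, ‖ψ o‖ ≤ 1) (hM : 0 < M)
    (hη : 0 ≤ η) (n : ℕ) :
    𝓜.tapeLaw.real {ω | ¬ Accurate (seqModel hθ hgap) (𝓜.env ψ ω) M n η} ≤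
      (n * (H * (A ^ H * (d + A)))) * (2 * Real.exp (-(M * (η ^ 2 / 2)))) := by
  let inaccurate (z : Fin n × Fin H × (Fin H → Fin A) × (Fin d ⊕ Fin A)) : Set (Tape S O A) :=
    let l := (List.ofFn z.2.2.1).take z.2.1
    z.2.2.2.elim
      (fun i => {ω | η < |empiricalFeature (𝓜.env ψ ω) M z.1 l i - (seqModel hθ hgap).μ l i|})
      (fun a => {ω | η < |empiricalReward (𝓜.env ψ ω) M z.1 l a - (seqModel hθ hgap).r l a|})
  have hinaccurate (z) : 𝓜.tapeLaw.real (inaccurate z) ≤ 2 * Real.exp (-(M * (η ^ 2 / 2))) := by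
    obtain ⟨e, h, g, i | a⟩ := z
    · exact tapeLaw_real_lt_abs_empiricalFeature_sub_le hψ hψ₁ hM hη e _ i
    · exact tapeLaw_real_lt_abs_empiricalReward_sub_le hM hη e _ a
  have hsub : {ω | ¬ Accurate (seqModel hθ hgap) (𝓜.env ψ ω) M n η} ⊆ ⋃ z, inaccurate z := by
    refine fun ω => not_imp_comm.1 fun hω e he l hl => ?_
    simp only [Set.mem_iUnion, not_exists] at hω
    obtain ⟨g, hg⟩ := exists_eq_take_ofFn hl.le
    have hle := fun x => hω (⟨e, by omega⟩, ⟨l.length, hl⟩, g, x)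
    simp only [inaccurate, ← hg] at hle
    exact ⟨fun i => not_lt.1 (hle (.inl i)), fun a => not_lt.1 (hle (.inr a))⟩
  calc 𝓜.tapeLaw.real {ω | ¬ Accurate (seqModel hθ hgap) (𝓜.env ψ ω) M n η}
      ≤ 𝓜.tapeLaw.real (⋃ z, inaccurate z) := measureReal_mono hsub
    _ ≤ ∑ z, 𝓜.tapeLaw.real (inaccurate z) := measureReal_iUnion_fintype_le _
    _ ≤ ∑ _z, 2 * Real.exp (-(M * (η ^ 2 / 2))) := Finset.sum_le_sum fun z _ => hinaccurate z
    _ = (n * (H * (A ^ H * (d + A)))) * (2 * Real.exp (-(M * (η ^ 2 / 2)))) := by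
      simp only [Finset.sum_const, Finset.card_univ, Fintype.card_prod, Fintype.card_fin,
        Fintype.card_pi_const, Fintype.card_sum, nsmul_eq_mul]
      push_cast
      rfl

end DetPOMDP

section CostPolynomial

section CommSemiring

variable {R R' : Type*} [CommSemiring R] [CommSemiring R']

theorem map_totalCost (f : R →+* R') (H A d M N : R) :
    f (totalCost H A d M N) = totalCost (f H) (f A) (f d) (f M) (f N) := by
  simp [totalCost, roundCost, pointCost, actionCost, nodeCost, sampleCost, greedyCost, coverCost,
    inverseCost, map_ofNat]

theorem cast_totalCost (H A d M N : ℕ) :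
    ((totalCost H A d M N : ℕ) : R) = totalCost (H : R) A d M N :=
  map_totalCost (Nat.castRingHom R) H A d M N

theorem totalCost_one_mul_add_one (H A d M N : R) :
    totalCost H A d 1 N * (M + 1) = totalCost H A d (M + 1) N + totalCost H A d 0 N * M := by
  simp only [totalCost, roundCost, pointCost, actionCost, nodeCost, sampleCost]
  ring

/-- A bound for the size of the datasets, where `D` is the inverse of the gap. -/
def sizeBound (d Θ D : R) : R := 2 * d * (1 + 8 * Θ * D) ^ 4

/-- The inverse of the accuracy that is required of the empirical means. -/
def inverseAccuracy (H d Θ D : R) : R := 8 * D * (sizeBound d Θ D + 1) * (H + d * Θ)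

/-- A polynomial that dominates the logarithm of the number of empirical means, up to the number
`A ^ H` of sequences of actions. -/
def logBound (H d Θ D A : R) : R :=
  8 * inverseAccuracy H d Θ D ^ 2 * totalCost H A d 1 (sizeBound d Θ D) * (H * (d + A))

/-- The number of samples per empirical mean, before rounding, where `L` is the logarithm of the
inverse of the failure probability. -/
def sampleSize (H d Θ L D A : R) : R :=
  4 * inverseAccuracy H d Θ D ^ 2 * (L + H * A + logBound H d Θ D A)

/-- The total cost as a polynomial in the parameters of the problem. -/
def costBound (H d Θ L D A : R) : R :=
  totalCost H A d (sampleSize H d Θ L D A + 2) (sizeBound d Θ D)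

theorem map_costBound (f : R →+* R') (H d Θ L D A : R) :
    f (costBound H d Θ L D A) = costBound (f H) (f d) (f Θ) (f L) (f D) (f A) := by
  simp [costBound, sampleSize, logBound, inverseAccuracy, sizeBound, map_totalCost, map_ofNat]

end CommSemiring

section Order

variable {R : Type*} [CommSemiring R] [PartialOrder R] [IsStrictOrderedRing R] {H A d M M' N N' : R}

theorem totalCost_nonneg (hH : 0 ≤ H) (hA : 0 ≤ A) (hd : 0 ≤ d) (hM : 0 ≤ M) (hN : 0 ≤ N) :
    0 ≤ totalCost H A d M N := by
  unfold totalCost roundCost pointCost actionCost nodeCost sampleCost greedyCost coverCost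
    inverseCost
  positivity

theorem totalCost_le_totalCost (hH : 0 ≤ H) (hA : 0 ≤ A) (hd : 0 ≤ d) (hM : 0 ≤ M) (hMM' : M ≤ M')
    (hN : 0 ≤ N) (hNN' : N ≤ N') : totalCost H A d M N ≤ totalCost H A d M' N' := by
  have hM' := hM.trans hMM'
  have hN' := hN.trans hNN'
  unfold totalCost roundCost pointCost actionCost nodeCost sampleCost greedyCost coverCost
    inverseCost
  gcongr

end Order

/-- The polynomial that bounds the total cost. -/
noncomputable def costPolynomial : MvPolynomial (Fin 6) ℝ :=
  costBound (.X 0) (.X 1) (.X 2) (.X 3) (.X 4) (.X 5)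

theorem eval_costPolynomial (H d Θ L D A : ℝ) :
    MvPolynomial.eval ![H, d, Θ, L, D, A] costPolynomial = costBound H d Θ L D A := by
  rw [costPolynomial, map_costBound]
  simp

end CostPolynomial

section Tuning

variable {H d A : ℕ} {Θ δ Δ D L : ℝ}

/-- The parameters of the algorithm. -/
noncomputable def tunedParams (H d A : ℕ) (Θ δ Δ : ℝ) : Params where
  M := ⌈sampleSize (H : ℝ) d Θ (Real.log (1 / δ)) (1 / Δ) A⌉₊ + 1
  ε := 1 / (1 + 8 * Θ * (1 / Δ))
  lam := 1

theorem sizeBound_nonneg (hΘ : 0 ≤ Θ) (hD : 0 ≤ D) : 0 ≤ sizeBound (d : ℝ) Θ D := by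
  unfold sizeBound
  positivity

theorem inverseAccuracy_pos (hH : 0 < H) (hΘ : 0 ≤ Θ) (hD : 0 < D) :
    0 < inverseAccuracy (H : ℝ) d Θ D := by
  have := sizeBound_nonneg (d := d) hΘ hD.le
  unfold inverseAccuracy
  positivity

theorem logBound_nonneg (hΘ : 0 ≤ Θ) (hD : 0 ≤ D) : 0 ≤ logBound (H : ℝ) d Θ D A := by
  have := totalCost_nonneg (Nat.cast_nonneg (α := ℝ) H) A.cast_nonneg d.cast_nonneg zero_le_one
    (sizeBound_nonneg (d := d) hΘ hD)
  unfold logBound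
  positivity

theorem sampleSize_nonneg (hΘ : 0 ≤ Θ) (hL : 0 ≤ L) (hD : 0 ≤ D) :
    0 ≤ sampleSize (H : ℝ) d Θ L D A := by
  have := logBound_nonneg (H := H) (d := d) (A := A) hΘ hD
  unfold sampleSize
  positivity

theorem le_sizeBound {n : ℝ} (hΘ : 0 ≤ Θ) (hD : 0 ≤ D) (hn : 0 ≤ n)
    (h : n * (((1 / (1 + 8 * Θ * D)) ^ 2) ^ 2 / (1 + (1 / (1 + 8 * Θ * D)) ^ 2)) ≤ d) :
    n ≤ sizeBound (d : ℝ) Θ D := by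
  have hbound : sizeBound (d : ℝ) Θ D = 2 * d / (1 / (1 + 8 * Θ * D)) ^ 4 := by
    rw [sizeBound]
    field_simp
  have hε₀ : 0 < 1 / (1 + 8 * Θ * D) := by positivity
  have hε₁ : 1 / (1 + 8 * Θ * D) ≤ 1 :=
    div_le_self zero_le_one (le_add_of_nonneg_right (by positivity))
  generalize 1 / (1 + 8 * Θ * D) = ε at *
  have hhalf : ε ^ 4 / 2 ≤ (ε ^ 2) ^ 2 / (1 + ε ^ 2) := by
    rw [← pow_mul]
    gcongr
    linarith [pow_le_one₀ hε₀.le hε₁ (n := 2)]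
  rw [hbound, le_div_iff₀ (by positivity)]
  linarith [mul_le_mul_of_nonneg_left hhalf hn]

theorem bias_add_noise_lt {N : ℝ} (hH : 0 < H) (hΘ : 0 ≤ Θ) (hΔ : 0 < Δ) (hN : 0 ≤ N)
    (hN' : N ≤ sizeBound (d : ℝ) Θ (1 / Δ)) :
    1 / (1 + 8 * Θ * (1 / Δ)) * Θ +
      N * (targetError H d Θ (1 / inverseAccuracy (H : ℝ) d Θ (1 / Δ)) *
        (1 / (1 + 8 * Θ * (1 / Δ)))) +
      d * Θ * (1 / inverseAccuracy (H : ℝ) d Θ (1 / Δ)) < Δ / 2 := by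
  have hbias : 1 / (1 + 8 * Θ * (1 / Δ)) * Θ ≤ Δ / 8 := by
    rw [one_div_mul_eq_div, div_le_iff₀ (by positivity)]
    field_simp
    linarith
  have hε : 1 / (1 + 8 * Θ * (1 / Δ)) ≤ 1 :=
    div_le_self zero_le_one (le_add_of_nonneg_right (by positivity))
  have hpos := inverseAccuracy_pos (d := d) hH hΘ (one_div_pos.2 hΔ)
  set η := 1 / inverseAccuracy (H : ℝ) d Θ (1 / Δ) with hη
  have herror : 0 ≤ targetError H d Θ η := by unfold targetError; positivity
  have htotal : (sizeBound (d : ℝ) Θ (1 / Δ) + 1) * targetError H d Θ η = Δ / 8 := by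
    rw [targetError, hη, inverseAccuracy]
    have := sizeBound_nonneg (d := d) hΘ (one_div_pos.2 hΔ).le
    field_simp
  have hregression : N * (targetError H d Θ η * (1 / (1 + 8 * Θ * (1 / Δ)))) ≤
      sizeBound (d : ℝ) Θ (1 / Δ) * targetError H d Θ η :=
    mul_le_mul hN' (mul_le_of_le_one_right herror hε) (by positivity) (hN.trans hN')
  have hfeature : d * Θ * η ≤ targetError H d Θ η :=
    mul_le_mul_of_nonneg_right (le_add_of_nonneg_left H.cast_nonneg) (one_div_pos.2 hpos).le
  linarith

theorem isTuned_tunedParams (hH : 0 < H) (hΘ : 0 ≤ Θ) (hΔ : 0 < Δ) :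
    IsTuned H d Θ Δ (tunedParams H d A Θ δ Δ) ⌊sizeBound (d : ℝ) Θ (1 / Δ)⌋₊
      (1 / inverseAccuracy (H : ℝ) d Θ (1 / Δ)) where
  M_pos := Nat.succ_pos _
  ε_pos := by simp only [tunedParams]; positivity
  lam_pos := one_pos
  Θ_nonneg := hΘ
  η_pos := one_div_pos.2 (inverseAccuracy_pos hH hΘ (one_div_pos.2 hΔ))
  size n hn := by
    simp only [tunedParams, div_one] at hn
    exact Nat.le_floor (le_sizeBound hΘ (one_div_pos.2 hΔ).le n.cast_nonneg hn)
  precise := by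
    simp only [tunedParams, Real.sqrt_one, one_mul, div_one]
    exact bias_add_noise_lt hH hΘ hΔ (Nat.cast_nonneg _)
      (Nat.floor_le (sizeBound_nonneg hΘ (one_div_pos.2 hΔ).le))

theorem totalCost_tunedParams_le (hΘ : 0 ≤ Θ) (hδ : 0 < δ) (hδ₁ : δ < 1) (hΔ : 0 < Δ) :
    ((totalCost H A d (tunedParams H d A Θ δ Δ).M ⌊sizeBound (d : ℝ) Θ (1 / Δ)⌋₊ : ℕ) : ℝ) ≤
      costBound (H : ℝ) d Θ (Real.log (1 / δ)) (1 / Δ) A := by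
  have hL : 0 ≤ Real.log (1 / δ) := Real.log_nonneg (one_le_one_div hδ hδ₁.le)
  have hD : 0 ≤ 1 / Δ := by positivity
  rw [cast_totalCost]
  refine totalCost_le_totalCost H.cast_nonneg A.cast_nonneg d.cast_nonneg (Nat.cast_nonneg _) ?_
    (Nat.cast_nonneg _) (Nat.floor_le (sizeBound_nonneg hΘ hD))
  simp only [tunedParams, Nat.cast_add, Nat.cast_one]
  linarith [Nat.ceil_lt_add_one (sampleSize_nonneg (H := H) (d := d) (A := A) hΘ hL hD)]

theorem cast_totalCost_floor_le {M : ℕ} {N : ℝ} (hN : 0 ≤ N) (hM : 0 < M) :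
    ((totalCost H A d M ⌊N⌋₊ : ℕ) : ℝ) ≤ totalCost (H : ℝ) A d 1 N * M := by
  obtain ⟨m, rfl⟩ := Nat.exists_eq_add_one_of_ne_zero hM.ne'
  rw [cast_totalCost, Nat.cast_succ, totalCost_one_mul_add_one]
  exact (totalCost_le_totalCost H.cast_nonneg A.cast_nonneg d.cast_nonneg (by positivity) le_rfl
    (Nat.cast_nonneg _) (Nat.floor_le hN)).trans (le_add_of_nonneg_right (mul_nonneg
      (totalCost_nonneg H.cast_nonneg A.cast_nonneg d.cast_nonneg le_rfl hN) m.cast_nonneg))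

theorem mul_pow_mul_exp_neg_le {K y : ℝ} (hδ : 0 < δ) (hK : 0 ≤ K)
    (hy : Real.log (1 / δ) + H * A + K ≤ y) :
    K * A ^ H * (y * Real.exp (-(2 * y))) ≤ δ := by
  have hle_exp (x : ℝ) : x ≤ Real.exp x := (le_add_of_nonneg_right zero_le_one).trans
    (Real.add_one_le_exp x)
  have hpow : (A : ℝ) ^ H ≤ Real.exp (H * A) := by
    rw [Real.exp_nat_mul]
    exact pow_le_pow_left₀ A.cast_nonneg (hle_exp A) H
  calc K * A ^ H * (y * Real.exp (-(2 * y)))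
      ≤ K * A ^ H * (Real.exp y * Real.exp (-(2 * y))) := by gcongr; exact hle_exp y
    _ ≤ Real.exp K * Real.exp (H * A) * (Real.exp y * Real.exp (-(2 * y))) := by
        gcongr
        exact hle_exp K
    _ = Real.exp (K + H * A + (y + -(2 * y))) := by rw [← Real.exp_add, ← Real.exp_add,
        ← Real.exp_add]
    _ ≤ Real.exp (Real.log δ) := by
        rw [one_div, Real.log_inv] at hy
        exact Real.exp_le_exp.2 (by linarith)
    _ = δ := Real.exp_log hδ

theorem failure_tunedParams_le (hH : 0 < H) (hΘ : 0 ≤ Θ) (hδ : 0 < δ) (hΔ : 0 < Δ) :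
    ((totalCost H A d (tunedParams H d A Θ δ Δ).M ⌊sizeBound (d : ℝ) Θ (1 / Δ)⌋₊ : ℕ) *
      (H * (A ^ H * (d + A)))) * (2 * Real.exp (-((tunedParams H d A Θ δ Δ).M *
        ((1 / inverseAccuracy (H : ℝ) d Θ (1 / Δ)) ^ 2 / 2)))) ≤ δ := by
  have hD : 0 < 1 / Δ := by positivity
  have hsize := sizeBound_nonneg (d := d) hΘ hD.le
  have hg := inverseAccuracy_pos (d := d) hH hΘ hD
  have hsample : sampleSize (H : ℝ) d Θ (Real.log (1 / δ)) (1 / Δ) A ≤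
      (tunedParams H d A Θ δ Δ).M :=
    (Nat.le_ceil _).trans (Nat.cast_le.2 (Nat.le_succ _))
  have hcost := cast_totalCost_floor_le (H := H) (A := A) (d := d)
    (M := (tunedParams H d A Θ δ Δ).M) hsize (Nat.succ_pos _)
  set M := (tunedParams H d A Θ δ Δ).M
  set B := totalCost (H : ℝ) A d 1 (sizeBound (d : ℝ) Θ (1 / Δ)) with hB
  have hlog := logBound_nonneg (H := H) (d := d) (A := A) hΘ hD.le
  rw [logBound, ← hB] at hlog
  rw [sampleSize, logBound, ← hB] at hsample
  set g := inverseAccuracy (H : ℝ) d Θ (1 / Δ)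
  calc _ ≤ (B * M * (H * (A ^ H * (d + A)))) * (2 * Real.exp (-(M * ((1 / g) ^ 2 / 2)))) := by
        gcongr
    _ = 8 * g ^ 2 * B * (H * (d + A)) * A ^ H *
        (M / (4 * g ^ 2) * Real.exp (-(2 * (M / (4 * g ^ 2))))) := by
        rw [show M * ((1 / g) ^ 2 / 2) = 2 * (M / (4 * g ^ 2)) by field_simp; norm_num]
        field_simp
        ring
    _ ≤ δ := mul_pow_mul_exp_neg_le hδ hlog ((le_div_iff₀' (by positivity)).2 hsample)

end Tuning

end EQDP

theorem mainTheorem6 :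
    ∃ poly : MvPolynomial (Fin 6) ℝ,
      ∀ (H d A : ℕ) [NeZero A] (Θ δ Δ : ℝ), 0 < H → 0 < δ → δ < 1 → 0 < Δ →
      ∃ p : EQDP.Params, 0 < p.M ∧ 0 < p.ε ∧ 0 < p.lam ∧
      ∀ (S : Type*) (O : Type*) [MeasurableSpace O] (𝓜 : EQDP.DetPOMDP S O A) (dₛ : ℕ)
        (ψ : O → EuclideanSpace ℝ (Fin d)) (φ : S → EuclideanSpace ℝ (Fin dₛ))
        (G : Fin H → Matrix (Fin d) (Fin dₛ) ℝ) (W : ℝ),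
        0 < dₛ → Measurable ψ → (∀ o, ‖ψ o‖ ≤ 1) →
        𝓜.IsMeanEmbedding H ψ φ G → 𝓜.LinearQstar H φ W → 𝓜.HasGap H Δ →
        Θ = W / (⨅ h : Fin H, EQDP.minSingularValue (G h)) →
        (∀ ω : EQDP.Tape S O A, ∃ (l : List (Fin A)) (c : ℕ),
          EQDP.Terminates (𝓜.env ψ ω) p H l c ∧
          (c : ℝ) ≤ MvPolynomial.eval
            ![(H : ℝ), (d : ℝ), Θ, Real.log (1 / δ), 1 / Δ, (A : ℝ)] poly) ∧
        𝓜.tapeLaw {ω | ¬ ∃ (l : List (Fin A)) (c : ℕ),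
          EQDP.Terminates (𝓜.env ψ ω) p H l c ∧ 𝓜.IsOptimalSeq H l} ≤ ENNReal.ofReal δ := by
  open EQDP in
  refine ⟨costPolynomial, fun H d A _ Θ δ Δ hH hδ hδ₁ hΔ => ?_⟩
  have htuned := isTuned_tunedParams (d := d) (A := A) (δ := δ) hH (abs_nonneg Θ) hΔ
  refine ⟨tunedParams H d A |Θ| δ Δ, htuned.M_pos, htuned.ε_pos, htuned.lam_pos, ?_⟩
  intro S O _ 𝓜 dₛ ψ φ G W hdₛ hψ hψ₁ hG hQ hgap hΘ
  have hΘ₀ : 0 ≤ Θ := hΘ ▸ div_nonneg (hQ.nonneg hH) (hG.iInf_minSingularValue_pos hdₛ hH).le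
  rw [abs_of_nonneg hΘ₀] at htuned ⊢
  choose! θ hθ using fun a h (hh : h < H) => hG.exists_isObservationWeight hdₛ hQ a hh
  rw [← hΘ] at hθ
  let regime (ω) (n) (hacc) : Regime (DetPOMDP.seqModel hθ hgap) (𝓜.env ψ ω) :=
    ⟨_, _, n, _, htuned, DetPOMDP.env_feat_dotProduct_self_le_one hψ₁ ω, hacc⟩
  refine ⟨fun ω => ?_, ?_⟩
  · obtain ⟨l, c, hterm, hc, -⟩ := (regime ω 0 (accurate_of_lt htuned.M_pos)).terminates
    rw [eval_costPolynomial]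
    exact ⟨l, c, hterm, (Nat.cast_le.2 hc).trans (totalCost_tunedParams_le hΘ₀ hδ hδ₁ hΔ)⟩
  · refine (ENNReal.le_ofReal_iff_toReal_le (measure_ne_top _ _) hδ.le).2 ?_
    refine ((measureReal_mono fun ω => mt fun hacc => ?_).trans
      (DetPOMDP.tapeLaw_real_not_accurate_le (hθ := hθ) (hgap := hgap) hψ hψ₁ htuned.M_pos
        htuned.η_pos.le _)).trans (failure_tunedParams_le hH hΘ₀ hδ hΔ)
    obtain ⟨l, c, hterm, -, hopt⟩ := (regime ω _ hacc).terminates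
    exact ⟨l, c, hterm, DetPOMDP.isOptimalSeq_of_optFrom (hopt le_rfl).1 (hopt le_rfl).2⟩
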